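/- **Proposition 3.1 (Bourgain–Gamburd machine).** There is an absolute constant $C>0$ with the following property. Let $G_0$ be a nontrivial finite group, let $S_0=\{s_1,\dots,s_k\}\subseteq G_0$ be a symmetric generating set with $k$ elements, let $0<\kappa,\beta<1$, and let $\delta:(0,\infty)\to(0,\infty)$ be a function with $0<\delta(\varepsilon)<\varepsilon$ for every $\varepsilon>0$. Suppose that the following three conditions hold for every quotient $G$ of $G_0$, where $\pi:G_0\to G$ is the quotient map. 1. (High multiplicity) Every faithful representation $\rho:G\to \mathrm{GL}_d(\mathbb C)$ with $d\ge 1$ satisfies $d\ge |G|^{\beta}$. 2. (Classification of approximate subgroups) For every $\varepsilon>0$, writing $\delta=\delta(\varepsilon)$, every $|G|^{\delta}$-approximate subgroup $A$ of $G$ either has size $|A|\ge |G|^{1-\varepsilon}$ or is contained in at most $[G:H]^{\varepsilon}/|G|^{\delta}$ left cosets of some subgroup $H\le G$. Here a $K$-approximate subgroup of $G$ is a finite symmetric set $A\subseteq G$ that contains $1$ and satisfies $AA\subseteq XA$ for some symmetric set $X\subseteq G$ with $|X|\le K$. 3. (Non-concentration) Let $\mu=\frac1k(\delta_{\pi(s_1)}+\dots+\delta_{\pi(s_k)})$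 be the push-forward to $G$ of the uniform probability measure on $S_0$, and let $\mu^{n}$ be its $n$-fold convolution power. There is an even integer $n$ with $0\le n\le \log|G|$ such that $\mu^{n}(H)\le [G:H]^{-\kappa}$ for all subgroups $H\le G$. Let $\lambda_1$ be the smallest nonzero eigenvalue of the Laplace operator $$\Delta f(x)=f(x)-\frac1k\sum_{s\in S_0} f(s^{-1}x)$$ of the Cayley graph $\mathrm{Cay}(G_0,S_0)$, acting on functions $f$ on $G_0$. Then $$\lambda_1\ \ge\ \beta\, e^{-C/\delta(\varepsilon)},\qquad \varepsilon=\tfrac14\min\{\beta,\kappa\}.$$ -/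

import Mathlib

open scoped Pointwise

noncomputable section

namespace BGMachine

/-- `A` is a `K`-approximate subgroup: it is symmetric, contains `1`, and `A * A ⊆ X * A` for some
symmetric set `X` with at most `K` elements. (Mathlib's `IsApproximateSubgroup` does not ask that
`X` be symmetric.) -/
structure IsApproxSubgroup {G : Type*} [Group G] (K : ℝ) (A : Finset G) : Prop where
  one_mem : (1 : G) ∈ A
  inv_mem : ∀ a ∈ A, a⁻¹ ∈ A
  exists_cover : ∃ X : Finset G, (∀ x ∈ X, x⁻¹ ∈ X) ∧ (X.card : ℝ) ≤ K ∧
    (A : Set G) * (A : Set G) ⊆ (X : Set G) * (A : Set G)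

section Measures

variable {G : Type*} [Group G] [Fintype G]

open Classical in
/-- The uniform probability measure on `S`, as a function. -/
def uniformMeasure (S : Finset G) : G → ℝ :=
  fun g => if g ∈ S then (S.card : ℝ)⁻¹ else 0

open Classical in
/-- The push-forward of a measure under a group homomorphism. Applied to `uniformMeasure S` with
`S = {s₁, …, s_k}` it is `(δ_{π s₁} + ⋯ + δ_{π s_k}) / k`. -/
def pushforward {G' : Type*} [Group G'] (π : G →* G') (μ : G → ℝ) : G' → ℝ :=
  fun y => ∑ x with π x = y, μ x

/-- Convolution of two functions on a finite group. -/
def conv (μ ν : G → ℝ) : G → ℝ :=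
  fun g => ∑ x, μ (g * x⁻¹) * ν x

open Classical in
/-- Convolution powers; the zeroth one is the Dirac mass at the identity. -/
def convPow (μ : G → ℝ) : ℕ → G → ℝ
  | 0 => fun g => if g = 1 then 1 else 0
  | n + 1 => conv μ (convPow μ n)

open Classical in
/-- The mass that `μ` gives to a subset. -/
def mass (μ : G → ℝ) (A : Set G) : ℝ :=
  ∑ x with x ∈ A, μ x

/-- The Laplace operator of the Cayley graph `Cay(G, S)`, for symmetric `S`:
`Δ f (x) = f x - (1 / |S|) ∑_{s ∈ S} f (s⁻¹ x)`. -/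
def laplacian (S : Finset G) : Module.End ℝ (G → ℝ) where
  toFun f := fun x => f x - (S.card : ℝ)⁻¹ * ∑ s ∈ S, f (s⁻¹ * x)
  map_add' f g := by
    funext x
    simp only [Pi.add_apply, Finset.sum_add_distrib]
    ring
  map_smul' c f := by
    funext x
    simp only [Pi.smul_apply, smul_eq_mul, RingHom.id_apply, ← Finset.mul_sum]
    ring

/-- The first nonzero eigenvalue of the Laplace operator of `Cay(G, S)`. (There are finitely many
eigenvalues, and a nonzero one exists as soon as `S` generates `G` and `G` is nontrivial.) -/
def lambda1 (S : Finset G) : ℝ :=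
  sInf {t : ℝ | t ≠ 0 ∧ (laplacian S).HasEigenvalue t}

end Measures

/-- Every faithful complex representation of `G`, on a nonzero space, has dimension at least
`|G| ^ β`. (Only the trivial group acts faithfully on the zero space.) -/
def HighMultiplicity (G : Type*) [Group G] (β : ℝ) : Prop :=
  ∀ (d : ℕ), 0 < d → ∀ ρ : G →* GL (Fin d) ℂ, Function.Injective ρ →
    (Nat.card G : ℝ) ^ β ≤ (d : ℝ)

/-- Every `|G| ^ δ`-approximate subgroup of `G` has size at least `|G| ^ (1 - ε)` or is contained in
at most `[G : H] ^ ε / |G| ^ δ` left cosets of some subgroup `H`. -/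
def ApproxSubgroupClassification (G : Type*) [Group G] (ε δ : ℝ) : Prop :=
  ∀ A : Finset G, IsApproxSubgroup ((Nat.card G : ℝ) ^ δ) A →
    (Nat.card G : ℝ) ^ (1 - ε) ≤ (A.card : ℝ) ∨
    ∃ (H : Subgroup G) (T : Finset (G ⧸ H)),
      (T.card : ℝ) ≤ (H.index : ℝ) ^ ε / (Nat.card G : ℝ) ^ δ ∧
      ∀ a ∈ A, (QuotientGroup.mk a : G ⧸ H) ∈ T

/-- For some even `n ≤ log |G|`, every subgroup `H` satisfies `μ ^ n (H) ≤ [G : H] ^ (-κ)`. -/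
def NonConcentration {G : Type*} [Group G] [Fintype G] (μ : G → ℝ) (κ : ℝ) : Prop :=
  ∃ n : ℕ, Even n ∧ (n : ℝ) ≤ Real.log (Nat.card G : ℝ) ∧
    ∀ H : Subgroup G, mass (convPow μ n) (H : Set G) ≤ (H.index : ℝ) ^ (-κ)

end BGMachine

end

/-!
The eigenspace of a nonzero eigenvalue of the Laplace operator is a representation of `G₀` by right
translations, and it consists of functions on the quotient `G` by the kernel; hence `1 - t` is an
eigenvalue of convolution by the pushed-forward measure `μ` on `G`, of multiplicity at least
`|G| ^ β`. Comparing traces, it suffices that `‖μ ^ n‖₂² ≤ |G| ^ (β / 2 - 1)` for some `n` of size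
`O(log |G|)`. The `ℓ²` norm of `μ ^ n` decreases substantially with every doubling of `n`: otherwise
the Balog–Szemerédi–Gowers theorem gives an approximate subgroup to which `μ ^ n` gives large mass.
By the classification and non-concentration such a set has nearly the size of `G`, and then `μ ^ n`
is already flat. This needs `|G| ^ δ` to be large; on a group of size `exp (O(1 / δ))`,
non-concentration says that the walk charges the complement of every proper subgroup, which gives a
gap polynomial in `1 / |G|`.
-/

namespace BGMachine

section SqNorm

variable {α : Type*} [Fintype α]

/-- The squared `ℓ²` norm of a real function on a finite type, for the counting measure. -/
def sqNorm (f : α → ℝ) : ℝ := ∑ x, f x ^ 2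

lemma sqNorm_nonneg (f : α → ℝ) : 0 ≤ sqNorm f := Finset.sum_nonneg fun _ _ => sq_nonneg _

lemma sqNorm_add_le (f g : α → ℝ) : sqNorm (f + g) ≤ 2 * (sqNorm f + sqNorm g) := by
  simp only [sqNorm, ← Finset.sum_add_distrib, Finset.mul_sum]
  exact Finset.sum_le_sum fun x _ => add_sq_le

lemma sqNorm_comp_equiv {β : Type*} [Fintype β] (f : α → ℝ) (e : β ≃ α) :
    sqNorm (f ∘ e) = sqNorm f :=
  e.sum_comp fun x => f x ^ 2

lemma sqNorm_mono {f g : α → ℝ} (hf : ∀ x, 0 ≤ f x) (hfg : ∀ x, f x ≤ g x) :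
    sqNorm f ≤ sqNorm g :=
  Finset.sum_le_sum fun x _ => pow_le_pow_left₀ (hf x) (hfg x) 2

end SqNorm

section Convolution

variable {G : Type*} [Group G] [Fintype G]

lemma conv_eq_sum_mul_inv_mul (μ ν : G → ℝ) (g : G) :
    conv μ ν g = ∑ x, μ x * ν (x⁻¹ * g) := by
  unfold conv
  refine Fintype.sum_equiv ((Equiv.inv G).trans (Equiv.mulLeft g)) _ _ fun x => ?_
  simp

lemma conv_assoc (μ ν τ : G → ℝ) : conv (conv μ ν) τ = conv μ (conv ν τ) := by
  funext g
  simp only [conv_eq_sum_mul_inv_mul _ _ g, conv_eq_sum_mul_inv_mul μ ν,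
    conv_eq_sum_mul_inv_mul ν τ, Finset.sum_mul, Finset.mul_sum]
  rw [Finset.sum_comm]
  refine Finset.sum_congr rfl fun x _ => ?_
  refine Fintype.sum_equiv (Equiv.mulLeft x⁻¹) _ _ fun y => ?_
  simp [mul_assoc]

lemma add_conv (f g h : G → ℝ) : conv (f + g) h = conv f h + conv g h := by
  funext x
  simp [conv, add_mul, Finset.sum_add_distrib]

lemma conv_add (f g h : G → ℝ) : conv f (g + h) = conv f g + conv f h := by
  funext x
  simp [conv, mul_add, Finset.sum_add_distrib]

lemma conv_smul (f g : G → ℝ) (c : ℝ) : conv f (c • g) = c • conv f g := by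
  funext x
  simp [conv, Finset.mul_sum, mul_left_comm]

lemma conv_inv (μ ν : G → ℝ) (g : G) :
    conv μ ν g⁻¹ = conv (fun x => ν x⁻¹) (fun x => μ x⁻¹) g := by
  rw [conv_eq_sum_mul_inv_mul]
  unfold conv
  refine Fintype.sum_equiv (Equiv.inv G) _ _ fun x => ?_
  simp [mul_comm]

lemma sum_conv (μ ν : G → ℝ) : ∑ x, conv μ ν x = (∑ x, μ x) * ∑ x, ν x := by
  simp only [conv_eq_sum_mul_inv_mul, Finset.sum_mul]
  rw [Finset.sum_comm]
  refine Finset.sum_congr rfl fun x _ => ?_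
  rw [← Finset.mul_sum]
  congr 1
  exact Equiv.sum_comp (Equiv.mulLeft x⁻¹) ν

lemma conv_nonneg {μ ν : G → ℝ} (hμ : ∀ x, 0 ≤ μ x) (hν : ∀ x, 0 ≤ ν x) (g : G) :
    0 ≤ conv μ ν g :=
  Finset.sum_nonneg fun _ _ => mul_nonneg (hμ _) (hν _)

/-- Young's inequality `‖f * g‖₂ ≤ ‖f‖₁ ‖g‖₂`. -/
lemma sqNorm_conv_le {f : G → ℝ} (hf : ∀ x, 0 ≤ f x) (g : G → ℝ) :
    sqNorm (conv f g) ≤ (∑ x, f x) ^ 2 * sqNorm g := by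
  have cauchy_schwarz (y : G) :
      conv f g y ^ 2 ≤ (∑ x, f x) * conv f (fun x => g x ^ 2) y := by
    rw [conv_eq_sum_mul_inv_mul, conv_eq_sum_mul_inv_mul]
    exact Finset.sum_sq_le_sum_mul_sum_of_sq_le_mul _ (fun i _ => hf i)
      (fun i _ => mul_nonneg (hf i) (sq_nonneg _)) fun i _ => le_of_eq (by ring)
  calc sqNorm (conv f g) ≤ ∑ y, (∑ x, f x) * conv f (fun x => g x ^ 2) y :=
        Finset.sum_le_sum fun y _ => cauchy_schwarz y
    _ = (∑ x, f x) ^ 2 * sqNorm g := by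
        rw [← Finset.mul_sum, sum_conv, sqNorm, sq, mul_assoc]

/-- Young's inequality `‖f * g‖₂ ≤ ‖f‖₂ ‖g‖₁`. -/
lemma sqNorm_conv_le_right (f : G → ℝ) {g : G → ℝ} (hg : ∀ x, 0 ≤ g x) :
    sqNorm (conv f g) ≤ (∑ x, g x) ^ 2 * sqNorm f := by
  calc sqNorm (conv f g) = sqNorm (conv (g ∘ Equiv.inv G) (f ∘ Equiv.inv G)) := by
        rw [← sqNorm_comp_equiv _ (Equiv.inv G)]
        exact congrArg sqNorm (funext fun x => conv_inv f g x)
    _ ≤ (∑ x, (g ∘ Equiv.inv G) x) ^ 2 * sqNorm (f ∘ Equiv.inv G) :=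
        sqNorm_conv_le (fun x => hg _) _
    _ = (∑ x, g x) ^ 2 * sqNorm f := by
        rw [sqNorm_comp_equiv]
        congr 2
        exact Equiv.sum_comp (Equiv.inv G) g

lemma convPow_zero_conv (μ f : G → ℝ) : conv (convPow μ 0) f = f := by
  funext g
  rw [conv_eq_sum_mul_inv_mul, Finset.sum_eq_single 1] <;> simp +contextual [convPow]

lemma conv_convPow_zero (μ f : G → ℝ) : conv f (convPow μ 0) = f := by
  funext g
  unfold conv
  rw [Finset.sum_eq_single 1] <;> simp +contextual [convPow]

lemma convPow_succ (μ : G → ℝ) (n : ℕ) : convPow μ (n + 1) = conv μ (convPow μ n) := rfl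

lemma convPow_one (μ : G → ℝ) : convPow μ 1 = μ := conv_convPow_zero μ μ

lemma convPow_add (μ : G → ℝ) (m n : ℕ) :
    convPow μ (m + n) = conv (convPow μ m) (convPow μ n) := by
  induction m with
  | zero => rw [Nat.zero_add, convPow_zero_conv]
  | succ m ih => rw [Nat.add_right_comm, convPow_succ, ih, convPow_succ, conv_assoc]

lemma conv_convPow_eq_smul {μ f : G → ℝ} {α : ℝ} (h : conv μ f = α • f) (n : ℕ) :
    conv (convPow μ n) f = α ^ n • f := by
  induction n with
  | zero => simp [convPow_zero_conv]
  | succ n ih => rw [convPow_succ, conv_assoc, ih, conv_smul, h, smul_smul, pow_succ]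

end Convolution

section Mass

lemma mass_nonneg {α : Type*} [Fintype α] {μ : α → ℝ} (hμ : ∀ x, 0 ≤ μ x) (A : Set α) :
    0 ≤ mass μ A :=
  Finset.sum_nonneg fun x _ => hμ x

variable {G : Type*} [Group G] [Fintype G]

lemma mass_conv (μ ν : G → ℝ) (A : Set G) :
    mass (conv μ ν) A = ∑ g, μ g * mass ν (g⁻¹ • A) := by
  classical
  simp only [mass, conv_eq_sum_mul_inv_mul, Finset.mul_sum]
  rw [Finset.sum_comm]
  refine Finset.sum_congr rfl fun g _ => ?_
  refine Finset.sum_equiv (Equiv.mulLeft g⁻¹) (fun x => ?_) fun x _ => rfl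
  simp [Set.mem_inv_smul_set_iff]

end Mass

section IsSymmProb

variable {G : Type*} [Group G] [Fintype G] {μ : G → ℝ}

/-- `μ` is (the density of) a symmetric probability measure on a finite group. -/
structure IsSymmProb (μ : G → ℝ) : Prop where
  nonneg : ∀ x, 0 ≤ μ x
  sum_eq_one : ∑ x, μ x = 1
  symm : ∀ x, μ x⁻¹ = μ x

lemma IsSymmProb.convPow (hμ : IsSymmProb μ) (n : ℕ) : IsSymmProb (convPow μ n) := by
  induction n with
  | zero =>
    refine ⟨fun x => ?_, ?_, fun x => ?_⟩
    · unfold BGMachine.convPow; split_ifs <;> norm_num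
    · rw [Finset.sum_eq_single 1] <;> simp +contextual [BGMachine.convPow]
    · by_cases h : x = 1 <;> simp [BGMachine.convPow, h]
  | succ n ih =>
    refine ⟨conv_nonneg hμ.nonneg ih.nonneg, ?_, fun x => ?_⟩
    · rw [convPow_succ, sum_conv, hμ.sum_eq_one, ih.sum_eq_one, one_mul]
    · have comm : conv (BGMachine.convPow μ n) μ = conv μ (BGMachine.convPow μ n) := by
        rw [← convPow_succ, convPow_add, convPow_one]
      rw [convPow_succ, conv_inv, funext ih.symm, funext hμ.symm, comm]

lemma IsSymmProb.sqNorm_le_one (hμ : IsSymmProb μ) : sqNorm μ ≤ 1 := by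
  rw [← hμ.sum_eq_one]
  refine Finset.sum_le_sum fun x hx => ?_
  have le_one : μ x ≤ 1 := hμ.sum_eq_one ▸ Finset.single_le_sum (fun y _ => hμ.nonneg y) hx
  exact pow_le_of_le_one (hμ.nonneg x) le_one two_ne_zero

lemma IsSymmProb.one_le_card_mul_sqNorm (hμ : IsSymmProb μ) :
    1 ≤ (Nat.card G : ℝ) * sqNorm μ := by
  have := sq_sum_le_card_mul_sum_sq (s := (Finset.univ : Finset G)) (f := μ)
  rwa [hμ.sum_eq_one, Finset.card_univ, one_pow, ← Nat.card_eq_fintype_card] at this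

lemma IsSymmProb.sqNorm_pos (hμ : IsSymmProb μ) : 0 < sqNorm μ :=
  pos_of_mul_pos_right (one_pos.trans_le hμ.one_le_card_mul_sqNorm) (Nat.cast_nonneg _)

lemma IsSymmProb.pushforward {G' : Type*} [Group G'] [Fintype G'] (hμ : IsSymmProb μ)
    (π : G →* G') : IsSymmProb (pushforward π μ) := by
  classical
  refine ⟨fun y => Finset.sum_nonneg fun x _ => hμ.nonneg x, ?_, fun y => ?_⟩
  · rw [← hμ.sum_eq_one]
    unfold BGMachine.pushforward
    convert Finset.sum_fiberwise Finset.univ π μ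
  · refine Finset.sum_equiv (Equiv.inv G) (fun x => ?_) fun x _ => (hμ.symm x).symm
    simp [inv_eq_iff_eq_inv]

lemma isSymmProb_uniformMeasure {S : Finset G} (hS : S.Nonempty) (hsymm : ∀ s ∈ S, s⁻¹ ∈ S) :
    IsSymmProb (uniformMeasure S) := by
  classical
  have inv_mem_iff (x : G) : x⁻¹ ∈ S ↔ x ∈ S :=
    ⟨fun h => inv_inv x ▸ hsymm _ h, hsymm x⟩
  refine ⟨fun x => ?_, ?_, fun x => ?_⟩
  · unfold uniformMeasure; positivity
  · simp [uniformMeasure, hS.card_ne_zero]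
  · simp only [uniformMeasure, inv_mem_iff]

end IsSymmProb

section DependentRandomChoice

open Finset

variable {α β : Type*} (A : Finset α) (C : Finset β) (E : α → β → Prop)
  [∀ a c, Decidable (E a c)]

/-- The number of common neighbours in `C` of the two components of `p`, in the bipartite graph
with adjacency relation `E`. -/
def codegree (p : α × α) : ℕ := #{c ∈ C | E p.1 c ∧ E p.2 c}

lemma sum_card_codegree_lt_le {τ : ℝ} (hτ : 0 ≤ τ) :
    ∑ c ∈ C, (#{p ∈ {a ∈ A | E a c} ×ˢ {a ∈ A | E a c} | (codegree C E p : ℝ) < τ} : ℝ) ≤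
      (#A : ℝ) ^ 2 * τ := by
  let D : Finset (α × α) := {p ∈ A ×ˢ A | (codegree C E p : ℝ) < τ}
  have double_count : ∑ c ∈ C,
      #{p ∈ {a ∈ A | E a c} ×ˢ {a ∈ A | E a c} | (codegree C E p : ℝ) < τ} =
        ∑ p ∈ D, codegree C E p := by
    refine Eq.trans (sum_congr rfl fun c _ => congrArg card ?_)
      (sum_card_bipartiteAbove_eq_sum_card_bipartiteBelow (s := C) (t := D)
        fun c p => E p.1 c ∧ E p.2 c)
    ext p
    simp only [D, bipartiteAbove, mem_filter, mem_product]
    tauto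
  have card_D_le : #D ≤ #A ^ 2 := (card_filter_le _ _).trans_eq (by rw [card_product, sq])
  rw [← Nat.cast_sum, double_count, Nat.cast_sum]
  calc ∑ p ∈ D, (codegree C E p : ℝ) ≤ #D * τ := by
        rw [← nsmul_eq_mul]
        exact sum_le_card_nsmul _ _ _ fun p hp => (mem_filter.1 hp).2.le
    _ ≤ (#A : ℝ) ^ 2 * τ := by gcongr; exact_mod_cast card_D_le

lemma pow_three_div_le_sum_sq {n K : ℝ} (hn : 0 < n) (hK : 0 < K) (hC : #C ≤ n)
    (hE : n ^ 2 / K ≤ #{p ∈ A ×ˢ C | E p.1 p.2}) :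
    n ^ 3 / K ^ 2 ≤ ∑ c ∈ C, (#{a ∈ A | E a c} : ℝ) ^ 2 := by
  have card_sq_le : (#{p ∈ A ×ˢ C | E p.1 p.2} : ℝ) ^ 2 ≤
      #C * ∑ c ∈ C, (#{a ∈ A | E a c} : ℝ) ^ 2 := by
    rw [card_filter, sum_product_right]
    simp only [← card_filter, Nat.cast_sum]
    exact sq_sum_le_card_mul_sum_sq
  refine le_of_mul_le_mul_left ?_ hn
  calc n * (n ^ 3 / K ^ 2) = (n ^ 2 / K) ^ 2 := by field_simp
    _ ≤ (#{p ∈ A ×ˢ C | E p.1 p.2} : ℝ) ^ 2 := by gcongr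
    _ ≤ #C * ∑ c ∈ C, (#{a ∈ A | E a c} : ℝ) ^ 2 := card_sq_le
    _ ≤ n * ∑ c ∈ C, (#{a ∈ A | E a c} : ℝ) ^ 2 := by gcongr

/-- Dependent random choice. -/
lemma exists_subset_codegree {n K L : ℝ} (hn : 0 < n) (hK : 0 < K) (hL : 0 < L) (hA : #A ≤ n)
    (hC : #C ≤ n) (hE : n ^ 2 / K ≤ #{p ∈ A ×ˢ C | E p.1 p.2}) :
    ∃ B ⊆ A,
      n ^ 2 / (2 * K ^ 2) ≤ #{p ∈ B ×ˢ B | n / (4 * K ^ 2) ≤ codegree C E p} ∧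
      (#{p ∈ B ×ˢ B | codegree C E p < n / (4 * L * K ^ 2)} : ℝ) ≤ n ^ 2 / L := by
  let N (c : β) : Finset α := {a ∈ A | E a c}
  let low (τ : ℝ) (c : β) : Finset (α × α) := {p ∈ N c ×ˢ N c | (codegree C E p : ℝ) < τ}
  have sum_low_le {τ : ℝ} (hτ : 0 ≤ τ) : ∑ c ∈ C, (#(low τ c) : ℝ) ≤ n ^ 2 * τ :=
    (sum_card_codegree_lt_le A C E hτ).trans (by gcongr)
  have le_sum_sq : n ^ 3 / K ^ 2 ≤ ∑ c ∈ C, (#(N c) : ℝ) ^ 2 :=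
    pow_three_div_le_sum_sq A C E hn hK hC hE
  have nonempty_C : C.Nonempty := by
    rw [nonempty_iff_ne_empty]
    rintro rfl
    rw [sum_empty] at le_sum_sq
    exact le_sum_sq.not_gt (by positivity)
  -- A `c` for which `#(N c) ^ 2` beats both penalty terms has both properties at once.
  obtain ⟨c, -, hc⟩ : ∃ c ∈ C, n ^ 2 / (2 * K ^ 2) ≤
      (#(N c) : ℝ) ^ 2 - #(low (n / (4 * K ^ 2)) c) - L * #(low (n / (4 * L * K ^ 2)) c) := by
    refine exists_le_of_sum_le nonempty_C ?_
    rw [sum_sub_distrib, sum_sub_distrib, ← mul_sum, sum_const, nsmul_eq_mul]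
    have low_first := sum_low_le (τ := n / (4 * K ^ 2)) (by positivity)
    have low_second := sum_low_le (τ := n / (4 * L * K ^ 2)) (by positivity)
    calc #C * (n ^ 2 / (2 * K ^ 2)) ≤ n * (n ^ 2 / (2 * K ^ 2)) := by gcongr
      _ = n ^ 3 / K ^ 2 - n ^ 2 * (n / (4 * K ^ 2)) - L * (n ^ 2 * (n / (4 * L * K ^ 2))) := by
          field_simp; ring
      _ ≤ _ := by gcongr
  have N_subset : N c ⊆ A := filter_subset _ _
  have card_split : (#(N c) : ℝ) ^ 2 =
      #{p ∈ N c ×ˢ N c | n / (4 * K ^ 2) ≤ codegree C E p} + #(low (n / (4 * K ^ 2)) c) := by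
    have := card_filter_add_card_filter_not (s := N c ×ˢ N c)
      fun p => n / (4 * K ^ 2) ≤ codegree C E p
    simp only [not_le] at this
    rw [← Nat.cast_add, this, card_product, Nat.cast_mul, sq]
  refine ⟨N c, N_subset, ?_, ?_⟩
  · have : 0 ≤ L * #(low (n / (4 * L * K ^ 2)) c) := by positivity
    linarith
  · have card_N_sq : (#(N c) : ℝ) ^ 2 ≤ n ^ 2 := by
      have : (#(N c) : ℝ) ≤ n := (Nat.cast_le.2 (card_le_card N_subset)).trans hA
      gcongr
    have : 0 ≤ n ^ 2 / (2 * K ^ 2) := by positivity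
    have : (0 : ℝ) ≤ #(low (n / (4 * K ^ 2)) c) := by positivity
    rw [le_div_iff₀ hL, mul_comm]
    linarith

end DependentRandomChoice

section PopularProducts

open Finset
open scoped Combinatorics.Additive

lemma card_mul_le_card_of_le_card_fiber {α β : Type*} [DecidableEq β] (s : Finset α)
    (t : Finset β) (f : α → β) {c : ℝ} (h : ∀ y ∈ t, c ≤ #{x ∈ s | f x = y}) :
    #t * c ≤ #s := by
  rw [← nsmul_eq_mul]
  refine (card_nsmul_le_sum t (fun y => (#{x ∈ s | f x = y} : ℝ)) c h).trans ?_
  rw [← Nat.cast_sum, sum_card_fiberwise_eq_card_filter]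
  exact_mod_cast card_filter_le _ _

variable {G : Type*} [Group G] [DecidableEq G] (A C : Finset G)

/-- The products `a * c`, with `a ∈ A` and `c ∈ C`, that have at least `t` such representations. -/
noncomputable def popularProducts (t : ℝ) : Finset G := {x ∈ A * C | t ≤ A.convolution C x}

variable {A C}

lemma mem_popularProducts {t : ℝ} (ht : 0 < t) {x : G} :
    x ∈ popularProducts A C t ↔ t ≤ A.convolution C x := by
  rw [popularProducts, mem_filter, and_iff_right_iff_imp]
  intro h
  rw [← convolution_pos]
  exact_mod_cast ht.trans_le h

lemma card_popularProducts_mul_le (t : ℝ) : #(popularProducts A C t) * t ≤ #A * #C := by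
  have := card_mul_le_card_of_le_card_fiber (A ×ˢ C) (popularProducts A C t)
    (fun p => p.1 * p.2) fun x hx => (mem_filter.1 hx).2
  rwa [card_product, Nat.cast_mul] at this

lemma mulEnergy_le {n t : ℝ} (ht : 0 ≤ t) (hA : #A ≤ n) :
    (Eₘ[A, C] : ℝ) ≤ n * #{p ∈ A ×ˢ C | p.1 * p.2 ∈ popularProducts A C t} + t * (#A * #C) := by
  let P := popularProducts A C t
  have sum_convolution (s : Finset G) :
      ∑ x ∈ s, (A.convolution C x : ℝ) = #{p ∈ A ×ˢ C | p.1 * p.2 ∈ s} := by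
    rw [← sum_card_fiberwise_eq_card_filter, Nat.cast_sum]
    rfl
  have popular_le : ∑ x ∈ P, (A.convolution C x : ℝ) ^ 2 ≤
      ∑ x ∈ P, n * (A.convolution C x : ℝ) := by
    refine sum_le_sum fun x _ => ?_
    rw [sq]
    gcongr
    exact (Nat.cast_le.2 convolution_le_card_left).trans hA
  have unpopular_le : ∑ x ∈ A * C with ¬ t ≤ A.convolution C x, (A.convolution C x : ℝ) ^ 2 ≤
      ∑ x ∈ A * C with ¬ t ≤ A.convolution C x, t * (A.convolution C x : ℝ) := by
    refine sum_le_sum fun x hx => ?_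
    rw [sq]
    gcongr
    exact (not_le.1 (mem_filter.1 hx).2).le
  calc (Eₘ[A, C] : ℝ) = ∑ x ∈ A * C, (A.convolution C x : ℝ) ^ 2 := by
        rw [mulEnergy_eq_sum_sq']; push_cast; rfl
    _ ≤ n * ∑ x ∈ P, (A.convolution C x : ℝ) +
          t * ∑ x ∈ A * C with ¬ t ≤ A.convolution C x, (A.convolution C x : ℝ) := by
        rw [← sum_filter_add_sum_filter_not (A * C) fun x => t ≤ A.convolution C x, mul_sum,
          mul_sum]
        exact add_le_add popular_le unpopular_le
    _ ≤ _ := by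
        rw [sum_convolution, sum_convolution]
        gcongr
        exact_mod_cast (card_filter_le _ _).trans_eq (card_product A C)

lemma le_card_mul_mem_popularProducts {n K : ℝ} (hn : 0 < n) (hK : 0 < K) (hA : #A ≤ n)
    (hC : #C ≤ n) (hE : n ^ 3 / K ≤ Eₘ[A, C]) :
    n ^ 2 / (2 * K) ≤ #{p ∈ A ×ˢ C | p.1 * p.2 ∈ popularProducts A C (n / (2 * K))} := by
  refine le_of_mul_le_mul_left ?_ hn
  have card_mul_card_le : (#A * #C : ℝ) ≤ n * n := by gcongr
  calc n * (n ^ 2 / (2 * K)) = n ^ 3 / K - n / (2 * K) * (n * n) := by field_simp; norm_num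
    _ ≤ Eₘ[A, C] - n / (2 * K) * (#A * #C) := by gcongr
    _ ≤ _ := sub_le_iff_le_add.2 (mulEnergy_le (by positivity) hA)

lemma card_popularProducts_le {n K : ℝ} (hn : 0 < n) (hK : 0 < K) (hA : #A ≤ n) (hC : #C ≤ n) :
    (#(popularProducts A C (n / K)) : ℝ) ≤ K * n := by
  refine le_of_mul_le_mul_right ?_ (by positivity : 0 < n / K)
  calc #(popularProducts A C (n / K)) * (n / K) ≤ #A * #C := card_popularProducts_mul_le _
    _ ≤ n * n := by gcongr
    _ = K * n * (n / K) := by field_simp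

end PopularProducts

section SmallTripling

open Finset
open scoped Combinatorics.Additive

variable {G : Type*} [Group G] [DecidableEq G]

/-- If `p.1 * c` and `p.2 * c` both lie in `P`, their quotient is `p.1 * p.2⁻¹` whatever `c` is. -/
lemma card_image_mul_inv_mul_le (C P : Finset G) {τ : ℝ} (D : Finset (G × G))
    (hD : ∀ p ∈ D, τ ≤ codegree C (fun a c => a * c ∈ P) p) :
    #(D.image fun p => p.1 * p.2⁻¹) * τ ≤ (#P : ℝ) ^ 2 := by
  have h := card_mul_le_card_of_le_card_fiber (c := τ) (P ×ˢ P) (D.image fun p => p.1 * p.2⁻¹)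
    (fun p => p.1 * p.2⁻¹) ?_
  · rwa [card_product, Nat.cast_mul, ← sq] at h
  · intro y hy
    obtain ⟨p, hp, rfl⟩ := mem_image.1 hy
    refine (hD p hp).trans (Nat.cast_le.2 ?_)
    refine card_le_card_of_injOn (fun c => (p.1 * c, p.2 * c)) (fun c hc => ?_)
      fun c _ c' _ h => mul_left_cancel (congrArg Prod.fst h)
    simp only [coe_filter, Set.mem_ofPred_eq] at hc
    simp [hc.2.1, hc.2.2]

lemma card_image_mul_inv_le {C P : Finset G} {n k t : ℝ} (hn : 0 < n) (ht : 0 < t)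
    (hP : #P ≤ k * n) (D : Finset (G × G))
    (hD : ∀ p ∈ D, n / t ≤ codegree C (fun a c => a * c ∈ P) p) :
    #(D.image fun p => p.1 * p.2⁻¹) ≤ t * k ^ 2 * n := by
  refine le_of_mul_le_mul_right ?_ (by positivity : 0 < n / t)
  calc #(D.image fun p => p.1 * p.2⁻¹) * (n / t) ≤ (#P : ℝ) ^ 2 :=
        card_image_mul_inv_mul_le C P D hD
    _ ≤ (k * n) ^ 2 := by gcongr
    _ = t * k ^ 2 * n * (n / t) := by field_simp

lemma mulEnergy_inv_right_eq_inv_left (B : Finset G) : Eₘ[B, B⁻¹] = Eₘ[B⁻¹, B] := by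
  rw [mulEnergy_eq_card_filter, mulEnergy_eq_card_filter]
  refine card_bij' (fun q _ => ((q.2.1⁻¹, q.1.1), (q.2.2, q.1.2⁻¹)))
    (fun q _ => ((q.1.2, q.2.2⁻¹), (q.1.1⁻¹, q.2.1))) ?_ ?_ ?_ ?_
  · rintro ⟨⟨a, b⟩, c, d⟩ h
    simp only [mem_filter, mem_product, mem_inv', inv_inv] at h ⊢
    refine ⟨by tauto, ?_⟩
    rw [inv_mul_eq_iff_eq_mul, ← mul_assoc, ← h.2, mul_inv_cancel_right]
  · rintro ⟨⟨a, b⟩, c, d⟩ h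
    simp only [mem_filter, mem_product, mem_inv', inv_inv] at h ⊢
    refine ⟨by tauto, ?_⟩
    rw [mul_inv_eq_iff_eq_mul, mul_assoc, ← h.2, inv_mul_cancel_left]
  all_goals simp

lemma card_mul_card_mul_card_le {α β γ : Type*} (X : Finset α) (Y : Finset β) (Z : Finset γ)
    (R : α → β → Prop) (R' : β → γ → Prop) [∀ x y, Decidable (R x y)]
    [∀ y z, Decidable (R' y z)] :
    #X * #Y * #Z ≤ #{t ∈ X ×ˢ Y ×ˢ Z | R t.1 t.2.1 ∧ R' t.2.1 t.2.2} +
      #{p ∈ X ×ˢ Y | ¬ R p.1 p.2} * #Z + #X * #{p ∈ Y ×ˢ Z | ¬ R' p.1 p.2} := by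
  classical
  let good : Finset (α × β × γ) := {t ∈ X ×ˢ Y ×ˢ Z | R t.1 t.2.1 ∧ R' t.2.1 t.2.2}
  let bad : Finset (α × β × γ) :=
    ({p ∈ X ×ˢ Y | ¬ R p.1 p.2} ×ˢ Z).map (Equiv.prodAssoc α β γ).toEmbedding
  let bad' : Finset (α × β × γ) := X ×ˢ {p ∈ Y ×ˢ Z | ¬ R' p.1 p.2}
  have cover : X ×ˢ Y ×ˢ Z ⊆ good ∪ bad ∪ bad' := by
    rintro ⟨x, y, z⟩ h
    simp only [good, bad, bad', mem_union, mem_filter, mem_map_equiv, mem_product,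
      Equiv.prodAssoc_symm_apply] at h ⊢
    tauto
  calc #X * #Y * #Z = #(X ×ˢ Y ×ˢ Z) := by rw [card_product, card_product, mul_assoc]
    _ ≤ #good + #bad + #bad' :=
        (card_le_card cover).trans ((card_union_le _ _).trans (by gcongr; exact card_union_le _ _))
    _ = _ := by rw [card_map, card_product, card_product]

lemma inv_convolution_eq_card_filter (A B : Finset G) (x : G) :
    A⁻¹.convolution B x = #{a ∈ A | a * x ∈ B} := by
  rw [← card_mul_eq]
  refine card_bij' (fun p _ => p.1⁻¹) (fun a _ => (a⁻¹, a * x)) ?_ ?_ ?_ ?_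
  · rintro ⟨a, b⟩ h
    simp only [mem_filter, mem_product, mem_inv'] at h ⊢
    obtain ⟨⟨ha, hb⟩, rfl⟩ := h
    simpa [ha] using hb
  · intro a h
    simpa using h
  · rintro ⟨a, b⟩ h
    simp only [mem_filter, mem_product] at h
    simp [← h.2]
  · simp

lemma card_mul_inv_notMem_le {B Y : Finset G} (hY : Y ⊆ B) (Q : Finset G) (x : G) :
    #{p ∈ {a ∈ B | a * x ∈ B} ×ˢ Y | p.1 * x * p.2⁻¹ ∉ Q} ≤
      #{p ∈ B ×ˢ B | p.1 * p.2⁻¹ ∉ Q} := by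
  refine card_le_card_of_injOn (fun p => (p.1 * x, p.2)) ?_ ?_
  · rintro ⟨a, b⟩ h
    simp only [coe_filter, mem_product, mem_filter, Set.mem_ofPred_eq] at h ⊢
    exact ⟨⟨h.1.1.2, hY h.1.2⟩, h.2⟩
  · rintro ⟨a, b⟩ _ ⟨a', b'⟩ _ h
    simpa using h

/-- The representations come from
`x₁ * x₂ * x₃ = a⁻¹ * (a * x₁ * b⁻¹) * (b * x₂ * c⁻¹) * (c * x₃)`. -/
lemma card_triples_le_card_fiber (B Q : Finset G) (x₁ x₂ x₃ : G) :
    #{t ∈ {a ∈ B | a * x₁ ∈ B} ×ˢ {b ∈ B | b * x₂ ∈ B} ×ˢ {c ∈ B | c * x₃ ∈ B} |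
      t.1 * x₁ * t.2.1⁻¹ ∈ Q ∧ t.2.1 * x₂ * t.2.2⁻¹ ∈ Q} ≤
    #{q ∈ B ×ˢ Q ×ˢ Q ×ˢ B | q.1⁻¹ * q.2.1 * q.2.2.1 * q.2.2.2 = x₁ * x₂ * x₃} := by
  refine card_le_card_of_injOn
    (fun t => (t.1, t.1 * x₁ * t.2.1⁻¹, t.2.1 * x₂ * t.2.2⁻¹, t.2.2 * x₃)) ?_ ?_
  · rintro ⟨a, b, c⟩ h
    simp only [coe_filter, mem_product, mem_filter, Set.mem_ofPred_eq] at h ⊢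
    exact ⟨by tauto, by group⟩
  · rintro ⟨a, b, c⟩ _ ⟨a', b', c'⟩ _ h
    simp only [Prod.mk.injEq] at h ⊢
    obtain ⟨rfl, hb, -, hc⟩ := h
    exact ⟨rfl, by simpa using hb, by simpa using hc⟩

lemma card_pow_three_mul_le {B S Q : Finset G} {n M : ℝ} (hM : 0 < M) (hn : 0 ≤ n)
    (hB : #B ≤ n) (hS : ∀ x ∈ S, n / M ≤ B⁻¹.convolution B x)
    (hQ : #{p ∈ B ×ˢ B | p.1 * p.2⁻¹ ∉ Q} ≤ n ^ 2 / (4 * M ^ 3)) :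
    #(S ^ 3) * (n ^ 3 / (2 * M ^ 3)) ≤ n ^ 2 * (#Q : ℝ) ^ 2 := by
  let X (x : G) : Finset G := {a ∈ B | a * x ∈ B}
  have le_card_X {x : G} (hx : x ∈ S) : n / M ≤ #(X x) :=
    (hS x hx).trans_eq (congrArg Nat.cast (inv_convolution_eq_card_filter B B x))
  have card_X_le (x : G) : #(X x) ≤ n := (Nat.cast_le.2 (card_filter_le _ _)).trans hB
  have card_bad_le (x y : G) :
      #{p ∈ X x ×ˢ X y | p.1 * x * p.2⁻¹ ∉ Q} ≤ n ^ 2 / (4 * M ^ 3) :=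
    (Nat.cast_le.2 (card_mul_inv_notMem_le (filter_subset _ _) Q x)).trans hQ
  have le_card_fiber : ∀ y ∈ S ^ 3, n ^ 3 / (2 * M ^ 3) ≤
      #{q ∈ B ×ˢ Q ×ˢ Q ×ˢ B | q.1⁻¹ * q.2.1 * q.2.2.1 * q.2.2.2 = y} := by
    intro y hy
    rw [pow_succ, sq] at hy
    obtain ⟨z, hz, x₃, hx₃, rfl⟩ := mem_mul.1 hy
    obtain ⟨x₁, hx₁, x₂, hx₂, rfl⟩ := mem_mul.1 hz
    have count := card_mul_card_mul_card_le (X x₁) (X x₂) (X x₃)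
      (fun a b => a * x₁ * b⁻¹ ∈ Q) fun b c => b * x₂ * c⁻¹ ∈ Q
    have le_fiber := card_triples_le_card_fiber B Q x₁ x₂ x₃
    refine le_trans ?_ (Nat.cast_le.2 le_fiber)
    rw [← Nat.cast_le (α := ℝ)] at count
    push_cast at count
    calc n ^ 3 / (2 * M ^ 3) =
          n / M * (n / M) * (n / M) - n ^ 2 / (4 * M ^ 3) * n - n * (n ^ 2 / (4 * M ^ 3)) := by
          field_simp; ring
      _ ≤ (#(X x₁) : ℝ) * #(X x₂) * #(X x₃) -
          #{p ∈ X x₁ ×ˢ X x₂ | p.1 * x₁ * p.2⁻¹ ∉ Q} * #(X x₃) -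
          #(X x₁) * #{p ∈ X x₂ ×ˢ X x₃ | p.1 * x₂ * p.2⁻¹ ∉ Q} := by
          gcongr
          · exact le_card_X hx₁
          · exact le_card_X hx₂
          · exact le_card_X hx₃
          · exact card_bad_le _ _
          · exact card_X_le _
          · exact card_X_le _
          · exact card_bad_le _ _
      _ ≤ _ := by linarith only [count]
  calc #(S ^ 3) * (n ^ 3 / (2 * M ^ 3)) ≤ #(B ×ˢ Q ×ˢ Q ×ˢ B) :=
        card_mul_le_card_of_le_card_fiber _ _ _ le_card_fiber
    _ = (#B : ℝ) ^ 2 * (#Q : ℝ) ^ 2 := by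
        simp only [card_product, Nat.cast_mul]; ring
    _ ≤ n ^ 2 * (#Q : ℝ) ^ 2 := by gcongr

lemma mulEnergy_inv_ge {B Q : Finset G} {n k : ℝ} (hn : 0 < n) (hk : 0 < k)
    (hQ : #Q ≤ 4 * k ^ 4 * n) (hB : n ^ 2 / (2 * k ^ 2) ≤ #{p ∈ B ×ˢ B | p.1 * p.2⁻¹ ∈ Q}) :
    n ^ 3 / (16 * k ^ 8) ≤ Eₘ[B⁻¹, B] := by
  have card_eq : #{p ∈ B ×ˢ B | p.1 * p.2⁻¹ ∈ Q} = #{p ∈ B ×ˢ B⁻¹ | p.1 * p.2 ∈ Q} :=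
    card_equiv ((Equiv.refl G).prodCongr (Equiv.inv G)) (by simp)
  have cauchy_schwarz : (#{p ∈ B ×ˢ B⁻¹ | p.1 * p.2 ∈ Q} : ℝ) ^ 2 ≤ #Q * Eₘ[B⁻¹, B] := by
    rw [← mulEnergy_inv_right_eq_inv_left]
    exact_mod_cast card_sq_le_card_mul_mulEnergy B B⁻¹ Q
  rw [card_eq] at hB
  refine le_of_mul_le_mul_left ?_ (by positivity : 0 < 4 * k ^ 4 * n)
  calc 4 * k ^ 4 * n * (n ^ 3 / (16 * k ^ 8)) = (n ^ 2 / (2 * k ^ 2)) ^ 2 := by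
        field_simp; norm_num
    _ ≤ (#{p ∈ B ×ˢ B⁻¹ | p.1 * p.2 ∈ Q} : ℝ) ^ 2 := by gcongr
    _ ≤ #Q * Eₘ[B⁻¹, B] := cauchy_schwarz
    _ ≤ 4 * k ^ 4 * n * Eₘ[B⁻¹, B] := by gcongr

lemma exists_subset_mulEnergy_inv {A C P : Finset G} {n k L : ℝ} (hn : 0 < n) (hk : 0 < k)
    (hL : 0 < L) (hA : #A ≤ n) (hC : #C ≤ n) (hP : #P ≤ k * n)
    (hE : n ^ 2 / k ≤ #{p ∈ A ×ˢ C | p.1 * p.2 ∈ P}) :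
    ∃ B ⊆ A, n ^ 3 / (16 * k ^ 8) ≤ Eₘ[B⁻¹, B] ∧ ∃ Q : Finset G, #Q ≤ 4 * L * k ^ 4 * n ∧
      #{p ∈ B ×ˢ B | p.1 * p.2⁻¹ ∉ Q} ≤ n ^ 2 / L := by
  obtain ⟨B, hBA, many_high, few_low⟩ :=
    exists_subset_codegree A C (fun a c => a * c ∈ P) hn hk hL hA hC hE
  let high (t : ℝ) : Finset (G × G) :=
    {p ∈ B ×ˢ B | n / t ≤ codegree C (fun a c => a * c ∈ P) p}
  let Q (t : ℝ) : Finset G := (high t).image fun p => p.1 * p.2⁻¹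
  have card_Q_le {t : ℝ} (ht : 0 < t) : #(Q t) ≤ t * k ^ 2 * n :=
    card_image_mul_inv_le hn ht hP (high t) fun p hp => (mem_filter.1 hp).2
  refine ⟨B, hBA, mulEnergy_inv_ge (Q := Q (4 * k ^ 2)) hn hk ?_ ?_, Q (4 * L * k ^ 2), ?_, ?_⟩
  · exact (card_Q_le (by positivity)).trans_eq (by ring)
  · refine many_high.trans (Nat.cast_le.2 (card_le_card fun p hp => ?_))
    exact mem_filter.2 ⟨(mem_filter.1 hp).1, mem_image_of_mem (fun p => p.1 * p.2⁻¹) hp⟩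
  · exact (card_Q_le (by positivity)).trans_eq (by ring)
  · refine le_trans (Nat.cast_le.2 (card_le_card fun p hp => ?_)) few_low
    rw [mem_filter] at hp ⊢
    refine ⟨hp.1, lt_of_not_ge fun hle => hp.2 ?_⟩
    exact mem_image_of_mem (fun p : G × G => p.1 * p.2⁻¹)
      (show p ∈ high _ from mem_filter.2 ⟨hp.1, hle⟩)

lemma exists_le_card_inter_smul {B S : Finset G} {n K : ℝ} (hn : 0 < n) (hK : 0 < K)
    (hB : #B ≤ n) (hS : n ^ 2 / K ≤ #{p ∈ B⁻¹ ×ˢ B | p.1 * p.2 ∈ S}) :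
    ∃ a : G, n / K ≤ #(B ∩ a • S) := by
  have nonempty_inv : B⁻¹.Nonempty := by
    rw [nonempty_iff_ne_empty]
    intro h
    rw [h, empty_product, filter_empty, card_empty, Nat.cast_zero] at hS
    exact hS.not_gt (by positivity)
  have sum_le : ∑ _ ∈ B⁻¹, n / K ≤ ∑ a ∈ B⁻¹, (#(B ∩ a⁻¹ • S) : ℝ) := by
    calc ∑ _ ∈ B⁻¹, n / K = #B * (n / K) := by rw [sum_const, card_inv, nsmul_eq_mul]
      _ ≤ n * (n / K) := by gcongr
      _ = n ^ 2 / K := by ring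
      _ ≤ #{p ∈ B⁻¹ ×ˢ B | p.1 * p.2 ∈ S} := hS
      _ = ∑ a ∈ B⁻¹, (#(B ∩ a⁻¹ • S) : ℝ) := by
          rw [card_filter, sum_product, Nat.cast_sum]
          refine sum_congr rfl fun a _ => ?_
          rw [← card_filter, ← filter_mem_eq_inter]
          simp only [mem_inv_smul_finset_iff, smul_eq_mul]
  obtain ⟨a, -, ha⟩ := exists_le_of_sum_le nonempty_inv sum_le
  exact ⟨a⁻¹, ha⟩

lemma exists_small_tripling_of_mulEnergy_inv {B Q : Finset G} {n M : ℝ} (hn : 0 < n)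
    (hM : 0 < M) (hB : #B ≤ n) (hE : n ^ 3 / M ≤ Eₘ[B⁻¹, B])
    (hQ : #{p ∈ B ×ˢ B | p.1 * p.2⁻¹ ∉ Q} ≤ n ^ 2 / (32 * M ^ 3)) :
    ∃ S : Finset G, 1 ∈ S ∧ S⁻¹ = S ∧
      #(S ^ 3) * (n ^ 3 / (16 * M ^ 3)) ≤ n ^ 2 * (#Q : ℝ) ^ 2 ∧
      ∃ a : G, n / (2 * M) ≤ #(B ∩ a • S) := by
  have pos : 0 < n / (2 * M) := by positivity
  have mem_S {x : G} := mem_popularProducts (A := B⁻¹) (C := B) pos (x := x)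
  obtain ⟨a, ha⟩ := exists_le_card_inter_smul hn (by positivity) hB
    (le_card_mul_mem_popularProducts hn hM (by rwa [card_inv]) hB hE)
  refine ⟨popularProducts B⁻¹ B (n / (2 * M)), ?_, ?_, ?_, a, ha⟩
  · rw [mem_S, inv_convolution_eq_card_filter]
    simpa using ha.trans (Nat.cast_le.2 (card_le_card inter_subset_left))
  · ext x
    rw [mem_inv', mem_S, mem_S, convolution_inv, inv_inv]
  · have := card_pow_three_mul_le (S := popularProducts B⁻¹ B (n / (2 * M))) (M := 2 * M)
      (by positivity) hn.le hB (fun x hx => mem_S.1 hx) (hQ.trans_eq (by ring))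
    rwa [show 2 * (2 * M) ^ 3 = 16 * M ^ 3 by ring] at this

/-- The Balog–Szemerédi–Gowers theorem in the form used by Bourgain and Gamburd. -/
theorem exists_small_tripling {A C : Finset G} {n K : ℝ} (hn : 0 < n) (hK : 0 < K) (hA : #A ≤ n)
    (hC : #C ≤ n) (hE : n ^ 3 / K ≤ Eₘ[A, C]) :
    ∃ S : Finset G, 1 ∈ S ∧ S⁻¹ = S ∧ #(S ^ 3) ≤ 2 ^ 134 * K ^ 80 * n ∧
      ∃ a : G, n / (2 ^ 13 * K ^ 8) ≤ #(A ∩ a • S) := by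
  obtain ⟨B, hBA, hEB, Q, hQ, few_bad⟩ := exists_subset_mulEnergy_inv (k := 2 * K)
    (L := 32 * (16 * (2 * K) ^ 8) ^ 3) hn (by positivity) (by positivity) hA hC
    (card_popularProducts_le hn (by positivity) hA hC)
    (le_card_mul_mem_popularProducts hn hK hA hC hE)
  obtain ⟨S, one_mem, inv_eq, card_pow_three, a, ha⟩ :=
    exists_small_tripling_of_mulEnergy_inv hn (by positivity)
      ((Nat.cast_le.2 (card_le_card hBA)).trans hA) hEB few_bad
  refine ⟨S, one_mem, inv_eq, ?_, a, ?_⟩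
  · refine le_of_mul_le_mul_right (card_pow_three.trans ?_)
      (by positivity : 0 < n ^ 3 / (16 * (16 * (2 * K) ^ 8) ^ 3))
    calc n ^ 2 * (#Q : ℝ) ^ 2
        ≤ n ^ 2 * (4 * (32 * (16 * (2 * K) ^ 8) ^ 3) * (2 * K) ^ 4 * n) ^ 2 := by gcongr
      _ = 2 ^ 134 * K ^ 80 * n * (n ^ 3 / (16 * (16 * (2 * K) ^ 8) ^ 3)) := by
          field_simp; norm_num
  · calc (n / (2 ^ 13 * K ^ 8) : ℝ) = n / (2 * (16 * (2 * K) ^ 8)) := by ring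
      _ ≤ (#(B ∩ a • S) : ℝ) := ha
      _ ≤ (#(A ∩ a • S) : ℝ) := by gcongr

end SmallTripling

section ApproximateSubgroups

open Finset

variable {G : Type*} [Group G]

lemma IsApproxSubgroup.mono {K K' : ℝ} {A : Finset G} (h : IsApproxSubgroup K A) (hK : K ≤ K') :
    IsApproxSubgroup K' A :=
  ⟨h.one_mem, h.inv_mem, h.exists_cover.imp fun _ hX => ⟨hX.1, hX.2.1.trans hK, hX.2.2⟩⟩

lemma isApproxSubgroup_sq [DecidableEq G] {S : Finset G} {K : ℝ} (h1 : 1 ∈ S) (hS : S⁻¹ = S)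
    (hK : (#(S ^ 3) : ℝ) ≤ K * #S) : IsApproxSubgroup (2 * K ^ 3) (S ^ 2) := by
  obtain ⟨F, card_F_le, cover⟩ := (IsApproximateSubgroup.of_small_tripling h1 hS hK).sq_covBySMul
  refine ⟨one_mem_pow h1, fun a ha => ?_, F ∪ F⁻¹, fun x hx => ?_, ?_, ?_⟩
  · rw [← mem_inv', ← inv_pow, hS]
    exact ha
  · rw [mem_union, mem_inv'] at hx ⊢
    rw [inv_inv]
    exact hx.symm
  · calc (#(F ∪ F⁻¹) : ℝ) ≤ #F + #F⁻¹ := mod_cast card_union_le F F⁻¹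
      _ ≤ 2 * K ^ 3 := by rw [card_inv]; linarith
  · rw [coe_pow, ← sq]
    refine cover.trans ?_
    rw [smul_eq_mul]
    exact Set.mul_subset_mul_right (by simp)

end ApproximateSubgroups

section Flattening

open Finset
open scoped Combinatorics.Additive

section Band

variable {α : Type*} [Fintype α] {ν : α → ℝ}

lemma sum_indicator_le (hν : ∀ x, 0 ≤ ν x) (A : Set α) :
    ∑ x, A.indicator ν x ≤ ∑ x, ν x :=
  sum_le_sum fun x _ => Set.indicator_le_self' (fun _ _ => hν _) x

lemma sqNorm_indicator_lt_le (hν : ∀ x, 0 ≤ ν x) {c : ℝ}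
    (hc : 0 ≤ c) : sqNorm ({x | ν x < c}.indicator ν) ≤ c * ∑ x, ν x := by
  rw [sqNorm, mul_sum]
  refine sum_le_sum fun x _ => ?_
  by_cases hx : ν x < c
  · rw [Set.indicator_of_mem (Set.mem_ofPred_eq ▸ hx), sq]
    exact mul_le_mul_of_nonneg_right hx.le (hν x)
  · rw [Set.indicator_of_notMem (Set.mem_ofPred_eq ▸ hx), sq, mul_zero]
    exact mul_nonneg hc (hν x)

lemma mul_sum_indicator_gt_le (hν : ∀ x, 0 ≤ ν x) (c : ℝ) :
    c * ∑ x, {x | c < ν x}.indicator ν x ≤ sqNorm ν := by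
  rw [sqNorm, mul_sum]
  refine sum_le_sum fun x _ => ?_
  by_cases hx : c < ν x
  · rw [Set.indicator_of_mem (Set.mem_ofPred_eq ▸ hx), sq]
    exact mul_le_mul_of_nonneg_right hx.le (hν x)
  · rw [Set.indicator_of_notMem (Set.mem_ofPred_eq ▸ hx), mul_zero]
    positivity

/-- The set where `ν` agrees with `‖ν‖₂²` up to a factor `U`. A probability measure `ν` that is not
flattened by convolution with itself behaves like the uniform measure on this set. -/
def band (ν : α → ℝ) (U : ℝ) : Set α := {x | sqNorm ν / U ≤ ν x ∧ ν x ≤ U * sqNorm ν}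

lemma indicator_band_add (ν : α → ℝ) {U : ℝ} (hU : 1 ≤ U) :
    (band ν U).indicator ν +
      ({x | ν x < sqNorm ν / U}.indicator ν + {x | U * sqNorm ν < ν x}.indicator ν) = ν := by
  have thresholds : sqNorm ν / U ≤ U * sqNorm ν :=
    (div_le_self (sqNorm_nonneg ν) hU).trans (le_mul_of_one_le_left (sqNorm_nonneg ν) hU)
  funext x
  simp only [Pi.add_apply, band, Set.indicator_apply, Set.mem_ofPred_eq]
  rcases lt_or_ge (ν x) (sqNorm ν / U) with low | not_low
  · simp [low, not_le.2 low, (low.le.trans thresholds).not_gt]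
  · rcases lt_or_ge (U * sqNorm ν) (ν x) with high | not_high
    · simp [not_low.not_gt, high, not_le.2 high]
    · simp [not_low, not_high, not_low.not_gt, not_high.not_gt]

lemma card_mul_le_mass (hν : ∀ x, 0 ≤ ν x) {A : Finset α} {B : Set α} {c : ℝ}
    (hA : ∀ x ∈ A, c ≤ ν x) (hAB : ∀ x ∈ A, x ∈ B) : #A * c ≤ mass ν B := by
  rw [← nsmul_eq_mul]
  refine (card_nsmul_le_sum _ _ _ hA).trans ?_
  exact sum_le_sum_of_subset_of_nonneg (fun x hx => by simpa using hAB x hx) fun x _ _ => hν x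

end Band

variable {G : Type*} [Group G] [Fintype G]

lemma sqNorm_conv_add_le {h l r : G → ℝ} {N s : ℝ} (hh : ∀ x, 0 ≤ h x) (hr : ∀ x, 0 ≤ r x)
    (sum_h : ∑ x, h x ≤ 1) (sq_h : sqNorm h ≤ N) (sq_l : sqNorm l ≤ s * N)
    (sum_r : ∑ x, r x ≤ s) (hs : s ≤ 1) :
    sqNorm (conv h (l + r)) ≤ 4 * (s * N) ∧ sqNorm (conv (l + r) h) ≤ 4 * (s * N) := by
  have sum_h_nonneg : 0 ≤ ∑ x, h x := sum_nonneg fun x _ => hh x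
  have sum_r_nonneg : 0 ≤ ∑ x, r x := sum_nonneg fun x _ => hr x
  have sum_h_sq : (∑ x, h x) ^ 2 ≤ 1 := pow_le_one₀ sum_h_nonneg sum_h
  have sum_r_sq : (∑ x, r x) ^ 2 ≤ s :=
    (pow_le_of_le_one sum_r_nonneg (sum_r.trans hs) two_ne_zero).trans sum_r
  have low : (∑ x, h x) ^ 2 * sqNorm l ≤ s * N :=
    (mul_le_of_le_one_left (sqNorm_nonneg l) sum_h_sq).trans sq_l
  have high : (∑ x, r x) ^ 2 * sqNorm h ≤ s * N :=
    mul_le_mul sum_r_sq sq_h (sqNorm_nonneg h) (sum_r_nonneg.trans sum_r)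
  constructor
  · rw [conv_add]
    linarith [sqNorm_add_le (conv h l) (conv h r), sqNorm_conv_le hh l, sqNorm_conv_le_right h hr]
  · rw [add_conv]
    linarith [sqNorm_add_le (conv l h) (conv r h), sqNorm_conv_le_right l hh, sqNorm_conv_le hr h]

lemma sqNorm_conv_indicator_band_ge {ν : G → ℝ} (hν : IsSymmProb ν) {U : ℝ} (hU : 1 ≤ U)
    (h : 40 * sqNorm ν / U ≤ sqNorm (conv ν ν)) :
    sqNorm ν / U ≤ sqNorm (conv ((band ν U).indicator ν) ((band ν U).indicator ν)) := by
  set f := (band ν U).indicator ν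
  set l := {x | ν x < sqNorm ν / U}.indicator ν
  set r := {x | U * sqNorm ν < ν x}.indicator ν
  have split : f + (l + r) = ν := indicator_band_add ν hU
  have f_nonneg (x : G) : 0 ≤ f x := Set.indicator_nonneg (fun _ _ => hν.nonneg _) x
  have r_nonneg (x : G) : 0 ≤ r x := Set.indicator_nonneg (fun _ _ => hν.nonneg _) x
  have sum_f : ∑ x, f x ≤ 1 := (sum_indicator_le hν.nonneg _).trans_eq hν.sum_eq_one
  have sq_f : sqNorm f ≤ sqNorm ν :=
    sqNorm_mono f_nonneg (Set.indicator_le_self' fun _ _ => hν.nonneg _)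
  have sq_l : sqNorm l ≤ U⁻¹ * sqNorm ν := by
    refine (sqNorm_indicator_lt_le hν.nonneg (by have := hν.sqNorm_pos; positivity)).trans_eq ?_
    rw [hν.sum_eq_one]
    ring
  have sum_r : ∑ x, r x ≤ U⁻¹ := by
    rw [← one_div, le_div_iff₀' (by positivity)]
    refine le_of_mul_le_mul_right ?_ hν.sqNorm_pos
    rw [mul_right_comm, one_mul]
    exact mul_sum_indicator_gt_le hν.nonneg _
  have inv_le_one : U⁻¹ ≤ 1 := inv_le_one_of_one_le₀ hU
  have expand : conv ν ν = conv f f + (conv f (l + r) + conv (l + r) ν) := by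
    rw [← add_assoc, ← conv_add, split, ← add_conv, split]
  have fe := (sqNorm_conv_add_le f_nonneg r_nonneg sum_f sq_f sq_l sum_r inv_le_one).1
  have eν := (sqNorm_conv_add_le hν.nonneg r_nonneg hν.sum_eq_one.le le_rfl sq_l sum_r
    inv_le_one).2
  have le_ff := sqNorm_add_le (conv f f) (conv f (l + r) + conv (l + r) ν)
  have le_rest := sqNorm_add_le (conv f (l + r)) (conv (l + r) ν)
  rw [← expand] at le_ff
  rw [mul_div_assoc, div_eq_inv_mul] at h
  rw [div_eq_inv_mul]
  linarith [mul_nonneg (inv_nonneg.2 (zero_le_one.trans hU)) (sqNorm_nonneg ν)]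

lemma conv_indicator [DecidableEq G] (A B : Finset G) (f g : G → ℝ) (x : G) :
    conv ((A : Set G).indicator f) ((B : Set G).indicator g) x =
      ∑ p ∈ A ×ˢ B with p.1 * p.2 = x, f p.1 * g p.2 := by
  classical
  rw [sum_filter, sum_product_right]
  simp only [conv, Set.indicator_apply, mem_coe, mul_ite, mul_zero, ite_mul, zero_mul,
    ← eq_mul_inv_iff_mul_eq, sum_ite_eq']
  rw [← sum_filter]
  simp only [filter_mem_eq_inter, univ_inter]

lemma sqNorm_conv_indicator_le [DecidableEq G] {A : Finset G} {ν : G → ℝ} {c : ℝ}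
    (hν : ∀ x, 0 ≤ ν x) (hA : ∀ x ∈ A, ν x ≤ c) :
    sqNorm (conv ((A : Set G).indicator ν) ((A : Set G).indicator ν)) ≤ c ^ 4 * Eₘ[A, A] := by
  rw [mulEnergy_eq_sum_sq, Nat.cast_sum, mul_sum]
  refine sum_le_sum fun x _ => ?_
  rw [conv_indicator]
  have le_card : ∑ p ∈ A ×ˢ A with p.1 * p.2 = x, ν p.1 * ν p.2 ≤
      #{p ∈ A ×ˢ A | p.1 * p.2 = x} * c ^ 2 := by
    rw [← nsmul_eq_mul, sq]
    refine sum_le_card_nsmul _ _ _ fun p hp => ?_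
    obtain ⟨h1, h2⟩ := mem_product.1 (mem_filter.1 hp).1
    exact mul_le_mul (hA _ h1) (hA _ h2) (hν _) ((hν _).trans (hA _ h1))
  refine (pow_le_pow_left₀ (sum_nonneg fun p _ => mul_nonneg (hν _) (hν _)) le_card 2).trans_eq ?_
  push_cast
  ring

lemma exists_large_mulEnergy [DecidableEq G] {ν : G → ℝ} (hν : IsSymmProb ν) {U : ℝ}
    (hU : 1 ≤ U) (h : 40 * sqNorm ν / U ≤ sqNorm (conv ν ν)) :
    ∃ A : Finset G, (∀ x ∈ A, sqNorm ν / U ≤ ν x) ∧ #A ≤ U / sqNorm ν ∧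
      (U / sqNorm ν) ^ 3 / U ^ 8 ≤ Eₘ[A, A] := by
  classical
  have N_pos := hν.sqNorm_pos
  have : 0 < U := one_pos.trans_le hU
  set A : Finset G := (band ν U).toFinset
  have coe_A : (A : Set G) = band ν U := Set.coe_toFinset _
  have mem_A {x : G} (hx : x ∈ A) : x ∈ band ν U := coe_A ▸ mem_coe.2 hx
  refine ⟨A, fun x hx => (mem_A hx).1, ?_, ?_⟩
  · rw [← inv_div, ← one_div, le_div_iff₀ (by positivity)]
    calc #A * (sqNorm ν / U) ≤ ∑ x ∈ A, ν x := by
          rw [← nsmul_eq_mul]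
          exact card_nsmul_le_sum _ _ _ fun x hx => (mem_A hx).1
      _ ≤ 1 := hν.sum_eq_one ▸ sum_le_univ_sum_of_nonneg hν.nonneg
  · have energy := sqNorm_conv_indicator_le hν.nonneg fun x hx => (mem_A hx).2
    rw [coe_A] at energy
    refine le_of_mul_le_mul_left ?_ (by positivity : 0 < (U * sqNorm ν) ^ 4)
    refine le_trans (le_of_eq ?_) ((sqNorm_conv_indicator_band_ge hν hU h).trans energy)
    field_simp

theorem exists_isApproxSubgroup_of_le_sqNorm_conv {ν : G → ℝ} (hν : IsSymmProb ν) {U : ℝ}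
    (hU : 40 ≤ U) (h : 40 * sqNorm ν / U ≤ sqNorm (conv ν ν)) :
    ∃ H : Finset G, IsApproxSubgroup (U ^ 2200) H ∧ #H * sqNorm ν ≤ U ^ 2200 ∧
      ∃ a : G, 1 ≤ U ^ 2200 * mass ν (a • (H : Set G)) := by
  classical
  have N_pos := hν.sqNorm_pos
  have U_ge_one : 1 ≤ U := by linarith
  have : 0 < U := by linarith
  have two_pow_le : (2 : ℝ) ^ 13 ≤ U ^ 3 :=
    (by norm_num : (2 : ℝ) ^ 13 ≤ 40 ^ 3).trans (by gcongr)
  have two_pow_le' : (2 : ℝ) ^ 134 ≤ U ^ 26 :=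
    (by norm_num : (2 : ℝ) ^ 134 ≤ 40 ^ 26).trans (by gcongr)
  obtain ⟨A, A_ge, card_A, energy⟩ := exists_large_mulEnergy hν U_ge_one h
  set n := U / sqNorm ν with hn
  have n_pos : 0 < n := by positivity
  obtain ⟨S, one_mem, inv_eq, tripling, a, card_inter⟩ :=
    exists_small_tripling n_pos (by positivity) card_A card_A energy
  have card_pow_three : (#(S ^ 3) : ℝ) ≤ U ^ 666 * n := by
    refine tripling.trans (mul_le_mul_of_nonneg_right ?_ n_pos.le)
    calc (2 : ℝ) ^ 134 * (U ^ 8) ^ 80 ≤ U ^ 26 * (U ^ 8) ^ 80 := by gcongr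
      _ = U ^ 666 := by ring
  have le_card_inter : n ≤ U ^ 67 * #(A ∩ a • S) := by
    rw [div_le_iff₀' (by positivity)] at card_inter
    refine card_inter.trans (mul_le_mul_of_nonneg_right ?_ (Nat.cast_nonneg _))
    calc (2 : ℝ) ^ 13 * (U ^ 8) ^ 8 ≤ U ^ 3 * (U ^ 8) ^ 8 := by gcongr
      _ = U ^ 67 := by ring
  have card_inter_le : #(A ∩ a • S) ≤ #S :=
    (card_le_card inter_subset_right).trans_eq (card_smul_finset a S)
  have small_tripling : (#(S ^ 3) : ℝ) ≤ U ^ 733 * #S :=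
    calc (#(S ^ 3) : ℝ) ≤ U ^ 666 * (U ^ 67 * #(A ∩ a • S)) :=
          card_pow_three.trans (by gcongr)
      _ ≤ U ^ 666 * (U ^ 67 * #S) := by gcongr
      _ = U ^ 733 * #S := by ring
  refine ⟨S ^ 2, (isApproxSubgroup_sq one_mem inv_eq small_tripling).mono ?_, ?_, a, ?_⟩
  · calc 2 * (U ^ 733) ^ 3 ≤ U * (U ^ 733) ^ 3 := by gcongr; linarith
      _ = U ^ 2200 := by ring
  · calc (#(S ^ 2) : ℝ) * sqNorm ν ≤ #(S ^ 3) * sqNorm ν := by gcongr; norm_num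
      _ ≤ U ^ 666 * n * sqNorm ν := by gcongr
      _ = U ^ 667 := by rw [hn]; field_simp
      _ ≤ U ^ 2200 := pow_le_pow_right₀ U_ge_one (by norm_num)
  · have S_subset : S ⊆ S ^ 2 := by
      simpa using pow_subset_pow_right one_mem (show 1 ≤ 2 by norm_num)
    have mass_ge : #(A ∩ a • S) * (sqNorm ν / U) ≤ mass ν (a • ((S ^ 2 : Finset G) : Set G)) := by
      refine card_mul_le_mass hν.nonneg (fun x hx => A_ge x (mem_of_mem_inter_left hx))
        fun x hx => ?_
      rw [← coe_smul_finset]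
      exact smul_finset_subset_smul_finset S_subset (mem_of_mem_inter_right hx)
    calc 1 = n * (sqNorm ν / U) := by rw [hn]; field_simp
      _ ≤ U ^ 67 * #(A ∩ a • S) * (sqNorm ν / U) := by gcongr
      _ = U ^ 67 * (#(A ∩ a • S) * (sqNorm ν / U)) := mul_assoc _ _ _
      _ ≤ U ^ 2200 * mass ν (a • ((S ^ 2 : Finset G) : Set G)) := by
          gcongr; norm_num

lemma mass_smul_le_card_mul {ν : G → ℝ} (hν : ∀ x, 0 ≤ ν x) {A : Finset G} {L : Subgroup G}
    {T : Finset (G ⧸ L)} (hT : ∀ a ∈ A, (a : G ⧸ L) ∈ T) {c : ℝ}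
    (hc : ∀ a : G, mass ν (a • (L : Set G)) ≤ c) (g : G) :
    mass ν (g • (A : Set G)) ≤ #T * c := by
  classical
  have union_bound : mass ν (g • (A : Set G)) ≤ ∑ y ∈ T, mass ν ((g * y.out) • (L : Set G)) := by
    unfold mass
    simp only [sum_filter]
    rw [sum_comm]
    refine sum_le_sum fun x _ => ?_
    have ite_nonneg (y : G ⧸ L) : 0 ≤ if x ∈ (g * y.out) • (L : Set G) then ν x else 0 :=
      ite_nonneg (hν x) le_rfl
    split_ifs with hx
    · rw [Set.mem_smul_set_iff_inv_smul_mem, smul_eq_mul, mem_coe] at hx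
      refine le_trans (le_of_eq (if_pos ?_).symm)
        (single_le_sum (fun y _ => ite_nonneg y) (hT _ hx))
      rw [Set.mem_smul_set_iff_inv_smul_mem, smul_eq_mul, mul_inv_rev, mul_assoc, SetLike.mem_coe,
        ← QuotientGroup.eq, QuotientGroup.out_eq']
    · exact sum_nonneg fun y _ => ite_nonneg y
  rw [← nsmul_eq_mul]
  exact union_bound.trans (sum_le_card_nsmul _ _ _ fun y _ => hc _)

theorem sqNorm_conv_self_le_or {ν : G → ℝ} (hν : IsSymmProb ν) {ε δ T : ℝ} (hδε : δ ≤ ε)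
    (classification : ApproxSubgroupClassification G ε δ)
    (hconc : ∀ (L : Subgroup G) (a : G), mass ν (a • (L : Set G)) ≤ (L.index : ℝ) ^ (-ε))
    (hT : 40 ≤ T) (T_pow : T ^ 5000 = (Nat.card G : ℝ) ^ δ) :
    sqNorm (conv ν ν) ≤ sqNorm ν / T ∨ sqNorm ν ≤ (Nat.card G : ℝ) ^ (2 * ε - 1) := by
  refine or_iff_not_imp_left.2 fun not_flat => ?_
  have T_gt_one : 1 < T := by linarith
  have card_pos : (0 : ℝ) < Nat.card G := Nat.cast_pos.2 Nat.card_pos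
  have card_ge_one : (1 : ℝ) ≤ Nat.card G := Nat.one_le_cast.2 Nat.card_pos
  have pow_lt : (40 * T) ^ 2200 < (Nat.card G : ℝ) ^ δ := by
    calc (40 * T) ^ 2200 ≤ (T * T) ^ 2200 := by gcongr
      _ = T ^ 4400 := by ring
      _ < T ^ 5000 := pow_lt_pow_right₀ T_gt_one (by norm_num)
      _ = _ := T_pow
  obtain ⟨H, approx, card_H, a, mass_H⟩ := exists_isApproxSubgroup_of_le_sqNorm_conv hν
    (U := 40 * T) (by linarith) (by
      rw [mul_div_mul_left _ _ (by norm_num)]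
      exact (not_le.1 not_flat).le)
  rcases classification H (approx.mono pow_lt.le) with large | ⟨L, Y, card_Y, cover⟩
  · refine le_of_mul_le_mul_left ?_ (Real.rpow_pos_of_pos card_pos (1 - ε))
    calc (Nat.card G : ℝ) ^ (1 - ε) * sqNorm ν ≤ #H * sqNorm ν := by
          gcongr; exact sqNorm_nonneg ν
      _ ≤ (Nat.card G : ℝ) ^ ε := (card_H.trans pow_lt.le).trans
          (Real.rpow_le_rpow_of_exponent_le card_ge_one hδε)
      _ = (Nat.card G : ℝ) ^ (1 - ε) * (Nat.card G : ℝ) ^ (2 * ε - 1) := by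
          rw [← Real.rpow_add card_pos]; congr 1; ring
  · have index_pos : (0 : ℝ) < L.index :=
      Nat.cast_pos.2 (Nat.pos_of_ne_zero L.index_ne_zero_of_finite)
    have mass_le : mass ν (a • (H : Set G)) ≤ ((Nat.card G : ℝ) ^ δ)⁻¹ :=
      calc mass ν (a • (H : Set G)) ≤ #Y * (L.index : ℝ) ^ (-ε) :=
            mass_smul_le_card_mul hν.nonneg cover (hconc L) a
        _ ≤ (L.index : ℝ) ^ ε / (Nat.card G : ℝ) ^ δ * (L.index : ℝ) ^ (-ε) := by gcongr
        _ = ((Nat.card G : ℝ) ^ δ)⁻¹ := by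
            rw [div_mul_eq_mul_div, ← Real.rpow_add index_pos, add_neg_cancel, Real.rpow_zero,
              one_div]
    refine absurd (mass_H.trans (mul_le_mul_of_nonneg_left mass_le (by positivity))) (not_le.2 ?_)
    rwa [← div_eq_mul_inv, div_lt_one (Real.rpow_pos_of_pos card_pos δ)]

end Flattening

section Escape

variable {G : Type*} [Group G] [Fintype G]

lemma sq_mass_smul_le {ν : G → ℝ} (ν_nonneg : ∀ g, 0 ≤ ν g) (ν_symm : ∀ g, ν g⁻¹ = ν g)
    (L : Subgroup G) (a : G) :
    mass ν (a • (L : Set G)) ^ 2 ≤ mass (conv ν ν) (L : Set G) := by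
  classical
  have coset_eq {g : G} (hg : g⁻¹ ∈ a • (L : Set G)) : g⁻¹ • (L : Set G) = a • (L : Set G) := by
    rw [Set.mem_smul_set_iff_inv_smul_mem, smul_eq_mul, SetLike.mem_coe] at hg
    exact ((leftCoset_eq_iff L).2 hg).symm
  have mass_eq : mass ν (a • (L : Set G)) = ∑ g with g⁻¹ ∈ a • (L : Set G), ν g :=
    Finset.sum_equiv (Equiv.inv G) (by simp) fun g _ => (ν_symm g).symm
  calc mass ν (a • (L : Set G)) ^ 2
      = ∑ g with g⁻¹ ∈ a • (L : Set G), ν g * mass ν (g⁻¹ • (L : Set G)) := by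
        rw [sq]
        conv_lhs => enter [1]; rw [mass_eq]
        rw [Finset.sum_mul]
        exact Finset.sum_congr rfl fun g hg => by rw [coset_eq (Finset.mem_filter.1 hg).2]
    _ ≤ ∑ g, ν g * mass ν (g⁻¹ • (L : Set G)) :=
        Finset.sum_le_univ_sum_of_nonneg fun g => mul_nonneg (ν_nonneg g) (mass_nonneg ν_nonneg _)
    _ = mass (conv ν ν) (L : Set G) := (mass_conv ν ν L).symm

lemma mass_conv_smul_le {μ ν : G → ℝ} (hμ : IsSymmProb μ) {A : Set G} {c : ℝ}
    (h : ∀ a : G, mass ν (a • A) ≤ c) (a : G) : mass (conv μ ν) (a • A) ≤ c := by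
  calc mass (conv μ ν) (a • A) = ∑ g, μ g * mass ν ((g⁻¹ * a) • A) := by
        simp only [mass_conv, smul_smul]
    _ ≤ ∑ g, μ g * c :=
        Finset.sum_le_sum fun g _ => mul_le_mul_of_nonneg_left (h _) (hμ.nonneg g)
    _ = c := by rw [← Finset.sum_mul, hμ.sum_eq_one, one_mul]

lemma exists_mass_convPow_smul_le {μ : G → ℝ} (hμ : IsSymmProb μ) {κ ε : ℝ} (hε : 2 * ε ≤ κ)
    (h : NonConcentration μ κ) :
    ∃ r : ℕ, r ≤ Real.log (Nat.card G) ∧ ∀ m ≥ r, ∀ (L : Subgroup G) (a : G),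
      mass (convPow μ m) (a • (L : Set G)) ≤ (L.index : ℝ) ^ (-ε) := by
  obtain ⟨n, ⟨r, rfl⟩, n_le_log, concentration⟩ := h
  refine ⟨r, le_trans (by push_cast; linarith [r.cast_nonneg (α := ℝ)]) n_le_log,
    fun m hm L a => ?_⟩
  obtain ⟨k, rfl⟩ := Nat.exists_eq_add_of_le' hm
  have index_ge_one : (1 : ℝ) ≤ L.index :=
    Nat.one_le_cast.2 (Nat.pos_of_ne_zero L.index_ne_zero_of_finite)
  rw [convPow_add]
  refine mass_conv_smul_le (hμ.convPow k) (fun b => ?_) a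
  have sq_le : mass (convPow μ r) (b • (L : Set G)) ^ 2 ≤ ((L.index : ℝ) ^ (-ε)) ^ 2 :=
    calc mass (convPow μ r) (b • (L : Set G)) ^ 2 ≤ mass (convPow μ (r + r)) (L : Set G) := by
          rw [convPow_add]
          exact sq_mass_smul_le (hμ.convPow r).nonneg (hμ.convPow r).symm L b
      _ ≤ (L.index : ℝ) ^ (-κ) := concentration L
      _ ≤ (L.index : ℝ) ^ (-ε + -ε) :=
          Real.rpow_le_rpow_of_exponent_le index_ge_one (by linarith)
      _ = ((L.index : ℝ) ^ (-ε)) ^ 2 := by rw [Real.rpow_add (by linarith), sq]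
  exact le_of_sq_le_sq sq_le (by positivity)

lemma sqNorm_convPow_two_pow_le {μ : G → ℝ} {r J : ℕ} {T : ℝ} (hT : 0 < T)
    (h0 : sqNorm (convPow μ r) ≤ 1)
    (h : ∀ j < J, sqNorm (convPow μ (2 ^ j * r + 2 ^ j * r)) ≤ sqNorm (convPow μ (2 ^ j * r)) / T) :
    sqNorm (convPow μ (2 ^ J * r)) ≤ 1 / T ^ J := by
  induction J with
  | zero => simpa using h0
  | succ J ih =>
    rw [pow_succ', mul_assoc, two_mul]
    calc sqNorm (convPow μ (2 ^ J * r + 2 ^ J * r)) ≤ sqNorm (convPow μ (2 ^ J * r)) / T :=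
          h J J.lt_succ_self
      _ ≤ 1 / T ^ J / T := by gcongr; exact ih fun j hj => h j (hj.trans J.lt_succ_self)
      _ = 1 / T ^ (J + 1) := by rw [div_div, pow_succ]

theorem exists_sqNorm_convPow_le {μ : G → ℝ} (hμ : IsSymmProb μ) {ε δ κ T : ℝ} (hδε : δ ≤ ε)
    (hεκ : 2 * ε ≤ κ) (classification : ApproxSubgroupClassification G ε δ)
    (hconc : NonConcentration μ κ) (hT : 40 ≤ T) (T_pow : T ^ 5000 = (Nat.card G : ℝ) ^ δ) {J : ℕ}
    (hJ : (Nat.card G : ℝ) < T ^ J) :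
    ∃ n : ℕ, n ≤ 2 ^ J * Real.log (Nat.card G) ∧
      sqNorm (convPow μ n) ≤ (Nat.card G : ℝ) ^ (2 * ε - 1) := by
  obtain ⟨r, r_le_log, coset_le⟩ := exists_mass_convPow_smul_le hμ hεκ hconc
  by_contra! never_flat
  have T_pos : 0 < T := by linarith
  have flattens (j : ℕ) (hj : j < J) :
      sqNorm (convPow μ (2 ^ j * r + 2 ^ j * r)) ≤ sqNorm (convPow μ (2 ^ j * r)) / T := by
    rw [convPow_add]
    refine (sqNorm_conv_self_le_or (hμ.convPow _) hδε classification
      (coset_le _ (Nat.le_mul_of_pos_left r (by positivity))) hT T_pow).resolve_right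
      (not_le.2 (never_flat _ ?_))
    push_cast
    gcongr
    exact one_le_two
  have too_flat := sqNorm_convPow_two_pow_le T_pos (hμ.convPow r).sqNorm_le_one flattens
  have := (hμ.convPow (2 ^ J * r)).one_le_card_mul_sqNorm
  rw [le_div_iff₀ (by positivity)] at too_flat
  nlinarith [(hμ.convPow (2 ^ J * r)).sqNorm_pos]

end Escape

section Generation

variable {G : Type*} [Group G] [Finite G]

lemma le_card_mul_of_closure_eq_top {ψ : G → ℝ} {S : Set G} {r : ℝ} (ψ_one : ψ 1 = 0)
    (ψ_mul_le : ∀ g h, ψ (g * h) ≤ ψ g + ψ h) (one_mem : 1 ∈ S) (hS : Subgroup.closure S = ⊤)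
    (h : ∀ s ∈ S, ψ s ≤ r) (g : G) : ψ g ≤ Nat.card G * r := by
  have := Fintype.ofFinite G
  have le_of_mem_pow (n : ℕ) : ∀ x ∈ S ^ n, ψ x ≤ n * r := by
    induction n with
    | zero => simp [ψ_one]
    | succ n ih =>
      rw [pow_succ]
      rintro _ ⟨x, hx, s, hs, rfl⟩
      push_cast
      linarith [ψ_mul_le x s, ih x hx, h s hs]
  have closure_le : Subgroup.closure S ≤ powCardSubgroup S ⟨1, one_mem⟩ :=
    (Subgroup.closure_le _).2 (Set.subset_pow one_mem Fintype.card_ne_zero)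
  rw [Nat.card_eq_fintype_card]
  exact le_of_mem_pow _ g (closure_le (hS ▸ Subgroup.mem_top g))

lemma index_rpow_neg_le {H : Subgroup G} (hH : H ≠ ⊤) {δ κ : ℝ} (hδ0 : 0 ≤ δ) (hδ1 : δ ≤ 1)
    (hδκ : δ ≤ κ) : (H.index : ℝ) ^ (-κ) ≤ 1 - δ / 2 := by
  have two_le_index : (2 : ℝ) ≤ H.index := by exact_mod_cast H.one_lt_index_of_ne_top hH
  calc (H.index : ℝ) ^ (-κ) ≤ (H.index : ℝ) ^ (-δ) :=
        Real.rpow_le_rpow_of_exponent_le (by linarith) (by linarith)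
    _ ≤ 2 ^ (-δ) := Real.rpow_le_rpow_of_nonpos two_pos two_le_index (by linarith)
    _ = (1 + -(1 / 2)) ^ δ := by rw [Real.rpow_neg two_pos.le, ← Real.inv_rpow two_pos.le]; norm_num
    _ ≤ 1 + δ * -(1 / 2) := rpow_one_add_le_one_add_mul_self (by norm_num) hδ0 hδ1
    _ = 1 - δ / 2 := by ring

end Generation

section SmallGroups

variable {G : Type*} [Group G] [Fintype G]

/-- The `ℓ²` distance between `f` and its left translate by `g`. As a function of `g` it is
subadditive. -/
noncomputable def translateDist (f : G → ℝ) (g : G) : ℝ :=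
  ‖WithLp.toLp 2 fun x => f (g⁻¹ * x) - f x‖

lemma translateDist_nonneg (f : G → ℝ) (g : G) : 0 ≤ translateDist f g := norm_nonneg _

lemma translateDist_sq (f : G → ℝ) (g : G) :
    translateDist f g ^ 2 = ∑ x, (f (g⁻¹ * x) - f x) ^ 2 := by
  simp [translateDist, EuclideanSpace.norm_sq_eq]

lemma translateDist_one (f : G → ℝ) : translateDist f 1 = 0 :=
  pow_eq_zero_iff two_ne_zero |>.1 (by simp [translateDist_sq])

lemma translateDist_mul_le (f : G → ℝ) (g h : G) :
    translateDist f (g * h) ≤ translateDist f g + translateDist f h := by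
  have translate : translateDist f h =
      ‖WithLp.toLp 2 fun x => f (h⁻¹ * (g⁻¹ * x)) - f (g⁻¹ * x)‖ := by
    rw [← sq_eq_sq₀ (translateDist_nonneg f h) (norm_nonneg _), translateDist_sq,
      EuclideanSpace.norm_sq_eq, ← Equiv.sum_comp (Equiv.mulLeft g⁻¹)]
    simp
  rw [translate, add_comm]
  refine le_trans (le_of_eq (congrArg norm ?_)) (norm_add_le _ _)
  ext x
  simp [mul_assoc]

/-- The Dirichlet form of `f` for the random walk with step weights `w`. -/
lemma sum_mul_translateDist_sq (w f : G → ℝ) :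
    ∑ g, w g * translateDist f g ^ 2 =
      2 * ((∑ g, w g) * sqNorm f) - 2 * ∑ x, conv w f x * f x := by
  have expand (g : G) :
      translateDist f g ^ 2 = 2 * sqNorm f - 2 * ∑ x, f (g⁻¹ * x) * f x := by
    have sq_translate : ∑ x, f (g⁻¹ * x) ^ 2 = sqNorm f :=
      sqNorm_comp_equiv f (Equiv.mulLeft g⁻¹)
    simp only [translateDist_sq, sub_sq, Finset.sum_add_distrib, Finset.sum_sub_distrib,
      sq_translate, mul_assoc, ← Finset.mul_sum]
    rw [← sqNorm]
    ring
  have pairing : ∑ g, w g * ∑ x, f (g⁻¹ * x) * f x = ∑ x, conv w f x * f x := by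
    simp only [conv_eq_sum_mul_inv_mul, Finset.mul_sum, Finset.sum_mul, ← mul_assoc]
    exact Finset.sum_comm
  simp only [expand, mul_sub, Finset.sum_sub_distrib, ← Finset.sum_mul, mul_left_comm _ (2 : ℝ),
    ← Finset.mul_sum, pairing]

lemma exists_le_translateDist_sq {f : G → ℝ} (hf : ∑ x, f x = 0) :
    ∃ g, 2 * sqNorm f ≤ translateDist f g ^ 2 := by
  have dirichlet := sum_mul_translateDist_sq (fun _ => 1) f
  have conv_one : conv (fun _ => 1) f = 0 := by
    funext x
    simp [conv, hf]
  simp only [conv_one, one_mul, Pi.zero_apply, zero_mul, Finset.sum_const_zero, mul_zero,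
    sub_zero] at dirichlet
  obtain ⟨g, -, hg⟩ := Finset.exists_le_of_sum_le (s := Finset.univ)
    (f := fun _ : G => 2 * sqNorm f) (g := fun g => translateDist f g ^ 2)
    Finset.univ_nonempty (by rw [dirichlet]; simp; linarith)
  exact ⟨g, hg⟩

lemma sum_notMem_eq_one_sub_mass {ν : G → ℝ} (hν : IsSymmProb ν) (A : Set G)
    [DecidablePred (· ∈ A)] : ∑ g with g ∉ A, ν g = 1 - mass ν A := by
  rw [eq_sub_iff_add_eq', ← hν.sum_eq_one,
    ← Finset.sum_filter_add_sum_filter_not Finset.univ (· ∈ A) ν, mass]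
  congr!

/-- Otherwise the elements that move `f` by little generate `G`, so that all of `G` moves `f` by
less than a function of mean zero allows. -/
theorem le_gap_of_mass_subgroup_le {ν f : G → ℝ} (hν : IsSymmProb ν) {c t : ℝ}
    (hc : ∀ H : Subgroup G, H ≠ ⊤ → mass ν (H : Set G) ≤ 1 - c) (hf0 : 0 < sqNorm f)
    (sum_f : ∑ x, f x = 0) (hf : conv ν f = (1 - t) • f) : c / (2 * (Nat.card G : ℝ) ^ 2) ≤ t := by
  classical
  have card_pos : (0 : ℝ) < Nat.card G := Nat.cast_pos.2 Nat.card_pos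
  set r := √(sqNorm f) / Nat.card G
  have r_sq : r ^ 2 = sqNorm f / (Nat.card G : ℝ) ^ 2 := by rw [div_pow, Real.sq_sqrt hf0.le]
  set S : Set G := {g | translateDist f g ≤ r}
  have closure_ne_top : Subgroup.closure S ≠ ⊤ := by
    intro closure_eq
    obtain ⟨g, hg⟩ := exists_le_translateDist_sq sum_f
    have one_mem : 1 ∈ S := (translateDist_one f).trans_le (by positivity)
    have le := le_card_mul_of_closure_eq_top (translateDist_one f) (translateDist_mul_le f) one_mem
      closure_eq (fun s hs => hs) g
    have := pow_le_pow_left₀ (translateDist_nonneg f g) le 2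
    rw [mul_pow, r_sq, mul_div_cancel₀ _ (by positivity)] at this
    linarith
  have dirichlet : ∑ g, ν g * translateDist f g ^ 2 = 2 * t * sqNorm f := by
    rw [sum_mul_translateDist_sq, hν.sum_eq_one, hf]
    simp only [Pi.smul_apply, smul_eq_mul, mul_assoc, ← sq, ← Finset.mul_sum]
    rw [← sqNorm]
    ring
  have lower : c * r ^ 2 ≤ 2 * t * sqNorm f := by
    calc c * r ^ 2 ≤ (1 - mass ν (Subgroup.closure S : Set G)) * r ^ 2 := by
          gcongr; linarith [hc _ closure_ne_top]
      _ = ∑ g with g ∉ (Subgroup.closure S : Set G), ν g * r ^ 2 := by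
          rw [← sum_notMem_eq_one_sub_mass hν, Finset.sum_mul]
      _ ≤ ∑ g with g ∉ (Subgroup.closure S : Set G), ν g * translateDist f g ^ 2 := by
          refine Finset.sum_le_sum fun g hg => mul_le_mul_of_nonneg_left ?_ (hν.nonneg g)
          refine pow_le_pow_left₀ (by positivity) (le_of_not_ge fun hle => ?_) 2
          exact (Finset.mem_filter.1 hg).2 (Subgroup.subset_closure hle)
      _ ≤ ∑ g, ν g * translateDist f g ^ 2 :=
          Finset.sum_le_univ_sum_of_nonneg fun g => mul_nonneg (hν.nonneg g) (sq_nonneg _)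
      _ = 2 * t * sqNorm f := dirichlet
  rw [r_sq, ← mul_div_assoc, div_le_iff₀ (by positivity)] at lower
  rw [div_le_iff₀ (by positivity)]
  exact le_of_mul_le_mul_right (by linarith) hf0

lemma sum_eq_zero_of_conv_eq_smul {μ f : G → ℝ} {α : ℝ} (hμ : ∑ x, μ x = 1) (hα : α ≠ 1)
    (hf : conv μ f = α • f) : ∑ x, f x = 0 := by
  have sum_eq := sum_conv μ f
  simp only [hf, hμ, one_mul, Pi.smul_apply, smul_eq_mul, ← Finset.mul_sum] at sum_eq
  refine (mul_eq_zero.1 ?_).resolve_left (sub_ne_zero.2 hα)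
  rw [sub_mul, sum_eq, one_mul, sub_self]

lemma sqNorm_pos_of_ne_zero {α : Type*} [Fintype α] {f : α → ℝ} (hf : f ≠ 0) : 0 < sqNorm f := by
  obtain ⟨x, hx⟩ := Function.ne_iff.1 hf
  exact Finset.sum_pos' (fun y _ => sq_nonneg (f y)) ⟨x, Finset.mem_univ x, sq_pos_of_ne_zero hx⟩

theorem le_gap_of_nonConcentration {μ f : G → ℝ} (hμ : IsSymmProb μ) {δ κ t : ℝ} (hδ0 : 0 < δ)
    (hδ1 : δ ≤ 1) (hδκ : δ ≤ κ) (hconc : NonConcentration μ κ) (hf0 : f ≠ 0) (ht : t ≠ 0)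
    (hf : conv μ f = (1 - t) • f) : δ / (4 * (Nat.card G : ℝ) ^ 3) ≤ t := by
  obtain ⟨n, -, n_le_log, concentration⟩ := hconc
  have card_ge_one : (1 : ℝ) ≤ Nat.card G := Nat.one_le_cast.2 Nat.card_pos
  have n_le_card : (n : ℝ) ≤ Nat.card G :=
    n_le_log.trans (Real.log_le_self (Nat.cast_nonneg _))
  have gap_pow : δ / 2 / (2 * (Nat.card G : ℝ) ^ 2) ≤ 1 - (1 - t) ^ n :=
    le_gap_of_mass_subgroup_le (hμ.convPow n)
      (fun H hH => (concentration H).trans (index_rpow_neg_le hH hδ0.le hδ1 hδκ))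
      (sqNorm_pos_of_ne_zero hf0)
      (sum_eq_zero_of_conv_eq_smul hμ.sum_eq_one (by simpa using ht) hf)
      (by rw [sub_sub_cancel, conv_convPow_eq_smul hf])
  rcases le_or_gt t 2 with t_le_two | t_gt_two
  · have bernoulli := one_add_mul_le_pow (a := -t) (by linarith) n
    have gap_le : δ / (4 * (Nat.card G : ℝ) ^ 2) ≤ n * t := by
      rw [← sub_eq_add_neg] at bernoulli
      calc δ / (4 * (Nat.card G : ℝ) ^ 2) = δ / 2 / (2 * (Nat.card G : ℝ) ^ 2) := by
            rw [div_div]; ring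
        _ ≤ n * t := by linarith
    have t_pos : 0 < t := pos_of_mul_pos_right (lt_of_lt_of_le (by positivity) gap_le) n.cast_nonneg
    calc δ / (4 * (Nat.card G : ℝ) ^ 3) = δ / (4 * (Nat.card G : ℝ) ^ 2) / Nat.card G := by
          rw [div_div]; ring
      _ ≤ t := by
          rw [div_le_iff₀' (by positivity)]
          exact gap_le.trans (by gcongr)
  · calc δ / (4 * (Nat.card G : ℝ) ^ 3) ≤ δ / 1 := by
          gcongr
          linarith [one_le_pow₀ card_ge_one (n := 3)]
      _ ≤ t := by linarith

end SmallGroups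

section Trace

variable {G : Type*} [Group G] [Fintype G]

/-- Bessel's inequality against the row `y ↦ μ (x * y⁻¹)` of the convolution matrix. -/
lemma sum_sq_conv_le_sqNorm (μ : G → ℝ) {ι : Type*} [Fintype ι] {v : ι → EuclideanSpace ℝ G}
    (hv : Orthonormal ℝ v) (x : G) : ∑ i, conv μ (v i) x ^ 2 ≤ sqNorm μ := by
  let row : EuclideanSpace ℝ G := WithLp.toLp 2 fun y => μ (x * y⁻¹)
  have norm_row : ‖row‖ ^ 2 = sqNorm μ := by
    rw [EuclideanSpace.norm_sq_eq]
    simpa [row, sqNorm] using sqNorm_comp_equiv μ ((Equiv.inv G).trans (Equiv.mulLeft x))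
  have inner_row (i : ι) : inner ℝ (v i) row = conv μ (v i) x := by
    simp [PiLp.inner_apply, row, conv]
  simpa [norm_row, inner_row] using hv.sum_inner_products_le row (s := Finset.univ)

theorem finrank_mul_sq_le {μ : G → ℝ} {α : ℝ} (W : Submodule ℝ (G → ℝ))
    (hW : ∀ f ∈ W, conv μ f = α • f) :
    (Module.finrank ℝ W : ℝ) * α ^ 2 ≤ Nat.card G * sqNorm μ := by
  let e : EuclideanSpace ℝ G ≃ₗ[ℝ] (G → ℝ) := WithLp.linearEquiv 2 ℝ (G → ℝ)
  let E : Submodule ℝ (EuclideanSpace ℝ G) := W.comap e.toLinearMap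
  have finrank_E : Module.finrank ℝ E = Module.finrank ℝ W :=
    (e.ofSubmodule' W).finrank_eq
  let b := stdOrthonormalBasis ℝ E
  have orthonormal : Orthonormal ℝ fun i => (b i : EuclideanSpace ℝ G) :=
    b.orthonormal.comp_linearIsometry E.subtypeₗᵢ
  have sqNorm_basis (i) : ∑ x, conv μ (b i : EuclideanSpace ℝ G) x ^ 2 = α ^ 2 := by
    have norm_sq := EuclideanSpace.real_norm_sq_eq (b i : EuclideanSpace ℝ G)
    rw [orthonormal.1 i, one_pow] at norm_sq
    have eigen : conv μ (b i : EuclideanSpace ℝ G) = α • _ := hW _ (b i).2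
    rw [eigen]
    simp [mul_pow, ← Finset.mul_sum, ← norm_sq]
  calc (Module.finrank ℝ W : ℝ) * α ^ 2
      = ∑ i, ∑ x, conv μ (b i : EuclideanSpace ℝ G) x ^ 2 := by
        simp [sqNorm_basis, finrank_E]
    _ = ∑ x, ∑ i, conv μ (b i : EuclideanSpace ℝ G) x ^ 2 := Finset.sum_comm
    _ ≤ ∑ _x : G, sqNorm μ :=
        Finset.sum_le_sum fun x _ => sum_sq_conv_le_sqNorm μ orthonormal x
    _ = Nat.card G * sqNorm μ := by simp

end Trace

section Laplacian

lemma laplacian_apply {G : Type*} [Group G] (S : Finset G) (f : G → ℝ) (x : G) :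
    laplacian S f x = f x - (S.card : ℝ)⁻¹ * ∑ s ∈ S, f (s⁻¹ * x) := rfl

variable {G : Type*} [Group G] [Fintype G]

lemma laplacian_comp {G' : Type*} [Group G'] [Fintype G'] (π : G →* G') (S : Finset G)
    (h : G' → ℝ) :
    laplacian S (h ∘ π) = (h - conv (pushforward π (uniformMeasure S)) h) ∘ π := by
  classical
  funext x
  simp only [laplacian_apply, Function.comp_apply, Pi.sub_apply, map_mul, map_inv,
    conv_eq_sum_mul_inv_mul, pushforward, Finset.sum_mul, Finset.sum_filter]
  rw [Finset.sum_comm]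
  simp [uniformMeasure, Finset.mul_sum]

lemma exists_hasEigenvalue_ne_zero {ι : Type*} [Fintype ι] {T : Module.End ℝ (ι → ℝ)}
    {A : Matrix ι ι ℝ} (hA : A.IsHermitian) (A_ne_zero : A ≠ 0) (hT : ∀ f, T f = A.mulVec f) :
    ∃ t, t ≠ 0 ∧ T.HasEigenvalue t := by
  classical
  obtain ⟨i, hi⟩ := Function.ne_iff.1 (mt hA.eigenvalues_eq_zero_iff.1 A_ne_zero)
  refine ⟨hA.eigenvalues i, hi, Module.End.hasEigenvalue_of_hasEigenvector
    (x := (hA.eigenvectorBasis i).ofLp) ⟨?_, ?_⟩⟩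
  · rw [Module.End.mem_eigenspace_iff, hT, hA.mulVec_eigenvectorBasis]
  · simpa using hA.eigenvectorBasis.toBasis.ne_zero i

/-- The matrix of `laplacian S`. -/
noncomputable def laplacianMatrix {G : Type*} [Group G] [DecidableEq G] (S : Finset G) :
    Matrix G G ℝ :=
  1 - Matrix.of fun x y => if x * y⁻¹ ∈ S then (S.card : ℝ)⁻¹ else 0

lemma laplacian_eq_mulVec [DecidableEq G] (S : Finset G) (f : G → ℝ) :
    laplacian S f = (laplacianMatrix S).mulVec f := by
  funext x
  have reindex : ∑ y with x * y⁻¹ ∈ S, f y = ∑ s ∈ S, f (s⁻¹ * x) :=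
    Finset.sum_bij' (fun y _ => x * y⁻¹) (fun s _ => s⁻¹ * x) (by simp) (by simp) (by simp)
      (by simp) (by simp)
  rw [laplacianMatrix, Matrix.sub_mulVec, Matrix.one_mulVec, laplacian_apply, ← reindex]
  simp [Matrix.mulVec, dotProduct, Finset.mul_sum, Finset.sum_filter]

lemma isHermitian_laplacianMatrix {G : Type*} [Group G] [DecidableEq G] {S : Finset G}
    (hS : ∀ s ∈ S, s⁻¹ ∈ S) : (laplacianMatrix S).IsHermitian := by
  refine Matrix.isHermitian_one.sub (Matrix.IsHermitian.ext fun x y => ?_)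
  have mem_comm : y * x⁻¹ ∈ S ↔ x * y⁻¹ ∈ S :=
    ⟨fun h => by simpa using hS _ h, fun h => by simpa using hS _ h⟩
  simp [mem_comm]

lemma laplacianMatrix_ne_zero {G : Type*} [Group G] [DecidableEq G] {S : Finset G} {s : G}
    (hs : s ∈ S) (s_ne_one : s ≠ 1) : laplacianMatrix S ≠ 0 := by
  intro h
  have entry : laplacianMatrix S s 1 = -(S.card : ℝ)⁻¹ := by
    simp [laplacianMatrix, s_ne_one, hs]
  rw [h] at entry
  simp [Finset.ne_empty_of_mem hs] at entry

lemma exists_mem_ne_one_of_closure_eq_top {G : Type*} [Group G] [Nontrivial G] {S : Set G}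
    (hS : Subgroup.closure S = ⊤) : ∃ s ∈ S, s ≠ 1 := by
  by_contra! h
  exact bot_ne_top (hS ▸ (Subgroup.closure_eq_bot_iff.2 h).symm)

theorem exists_laplacian_hasEigenvalue_ne_zero {G : Type*} [Group G] [Finite G]
    [Nontrivial G] {S : Finset G}
    (hS : ∀ s ∈ S, s⁻¹ ∈ S) (hgen : Subgroup.closure (S : Set G) = ⊤) :
    ∃ t : ℝ, t ≠ 0 ∧ (laplacian S).HasEigenvalue t := by
  classical
  have := Fintype.ofFinite G
  obtain ⟨s, hs, s_ne_one⟩ := exists_mem_ne_one_of_closure_eq_top hgen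
  exact exists_hasEigenvalue_ne_zero (isHermitian_laplacianMatrix hS)
    (laplacianMatrix_ne_zero hs s_ne_one) (laplacian_eq_mulVec S)

end Laplacian

section Quotient

variable {G : Type*} [Group G]

/-- Right translation acting on an eigenspace of the Laplace operator, which is built from left
translations and so commutes with it. -/
noncomputable def eigenspaceRep (S : Finset G) (t : ℝ) :
    G →* (Module.End ℝ ((laplacian S).eigenspace t))ˣ :=
  MonoidHom.toHomUnits
    { toFun g :=
        { toFun f := ⟨fun x => f.1 (x * g), by
            have eigen := Module.End.mem_eigenspace_iff.1 f.2
            refine Module.End.mem_eigenspace_iff.2 (funext fun x => ?_)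
            simpa [laplacian_apply, mul_assoc] using congrFun eigen (x * g)⟩
          map_add' _ _ := rfl
          map_smul' _ _ := rfl }
      map_one' := by ext; simp
      map_mul' g h := by ext; simp [mul_assoc] }

lemma apply_mul_of_mem_ker_eigenspaceRep {S : Finset G} {t : ℝ} {f : G → ℝ}
    (hf : f ∈ (laplacian S).eigenspace t) {g : G} (hg : g ∈ (eigenspaceRep S t).ker) (x : G) :
    f (x * g) = f x :=
  congrArg (fun T => (T.val ⟨f, hf⟩ : G → ℝ) x) (MonoidHom.mem_ker.1 hg)

lemma ker_eigenspaceRep_ne_top {S : Finset G} (hS : S.Nonempty) {t : ℝ} (ht : t ≠ 0)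
    (hev : (laplacian S).HasEigenvalue t) : (eigenspaceRep S t).ker ≠ ⊤ := by
  intro ker_eq_top
  obtain ⟨f, hf⟩ := hev.exists_hasEigenvector
  have constant (x) : f x = f 1 := by
    simpa using apply_mul_of_mem_ker_eigenspaceRep hf.1 (ker_eq_top ▸ Subgroup.mem_top x) 1
  have laplacian_f : laplacian S f = 0 := by
    funext x
    have : (S.card : ℝ) ≠ 0 := Nat.cast_ne_zero.2 hS.card_ne_zero
    simp [laplacian_apply, constant, this]
  exact smul_ne_zero ht hf.2 (hf.apply_eq_smul.symm.trans laplacian_f)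

/-- The functions on the quotient by the kernel of `eigenspaceRep S t` that pull back to
eigenfunctions. -/
noncomputable def quotientEigenspace (S : Finset G) (t : ℝ) :
    Submodule ℝ (G ⧸ (eigenspaceRep S t).ker → ℝ) :=
  ((laplacian S).eigenspace t).comap
    (LinearMap.funLeft ℝ ℝ (QuotientGroup.mk' (eigenspaceRep S t).ker))

lemma finrank_quotientEigenspace (S : Finset G) (t : ℝ) :
    Module.finrank ℝ (quotientEigenspace S t) =
      Module.finrank ℝ ((laplacian S).eigenspace t) := by
  set π := QuotientGroup.mk' (eigenspaceRep S t).ker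
  have pullback_injective : Function.Injective (LinearMap.funLeft ℝ ℝ π) :=
    LinearMap.funLeft_injective_of_surjective ℝ ℝ _ (QuotientGroup.mk'_surjective _)
  have eigenspace_le_range :
      (laplacian S).eigenspace t ≤ LinearMap.range (LinearMap.funLeft ℝ ℝ π) := by
    refine fun f hf => ⟨Quotient.lift f fun x y hxy => ?_, rfl⟩
    simpa using (apply_mul_of_mem_ker_eigenspaceRep hf (QuotientGroup.leftRel_apply.1 hxy) x).symm
  have map_eq : (quotientEigenspace S t).map (LinearMap.funLeft ℝ ℝ π) =
      (laplacian S).eigenspace t := by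
    rw [quotientEigenspace, Submodule.map_comap_eq, inf_eq_right.2 eigenspace_le_range]
  exact (Submodule.equivMapOfInjective _ pullback_injective _).finrank_eq.trans
    (congrArg (fun V : Submodule ℝ (G → ℝ) => Module.finrank ℝ V) map_eq)

lemma exists_mem_quotientEigenspace_ne_zero [Finite G] {S : Finset G} {t : ℝ}
    (hev : (laplacian S).HasEigenvalue t) : ∃ f ∈ quotientEigenspace S t, f ≠ 0 := by
  have := Submodule.nontrivial_iff_ne_bot.2 hev
  have finrank_pos : 0 < Module.finrank ℝ (quotientEigenspace S t) := by
    rw [finrank_quotientEigenspace]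
    exact Module.finrank_pos
  exact Submodule.exists_mem_ne_zero_of_ne_bot (Submodule.one_le_finrank_iff.1 finrank_pos)

lemma conv_eq_smul_of_mem_quotientEigenspace [Fintype G] {S : Finset G} {t : ℝ}
    [Fintype (G ⧸ (eigenspaceRep S t).ker)] {f : G ⧸ (eigenspaceRep S t).ker → ℝ}
    (hf : f ∈ quotientEigenspace S t) :
    conv (pushforward (QuotientGroup.mk' (eigenspaceRep S t).ker) (uniformMeasure S)) f =
      (1 - t) • f := by
  set π := QuotientGroup.mk' (eigenspaceRep S t).ker
  have eigen : laplacian S (f ∘ π) = t • (f ∘ π) := Module.End.mem_eigenspace_iff.1 hf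
  rw [laplacian_comp] at eigen
  have := (QuotientGroup.mk'_surjective (eigenspaceRep S t).ker).injective_comp_right
    (eigen.trans (rfl : _ = (t • f) ∘ π))
  rw [sub_smul, one_smul, ← this, sub_sub_cancel]

/-- A real representation of dimension `d` gives a faithful representation of the quotient by its
kernel in `GL_d(ℂ)`. -/
lemma HighMultiplicity.card_rpow_le_finrank {V : Type*} [AddCommGroup V] [Module ℝ V]
    [FiniteDimensional ℝ V] [Nontrivial V] (ρ : G →* (Module.End ℝ V)ˣ) {β : ℝ}
    (hβ : HighMultiplicity (G ⧸ ρ.ker) β) :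
    (Nat.card (G ⧸ ρ.ker) : ℝ) ^ β ≤ Module.finrank ℝ V := by
  let toMatrix := LinearMap.toMatrixAlgEquiv (Module.finBasis ℝ V)
  let toComplex := Complex.ofRealHom.mapMatrix (m := Fin (Module.finrank ℝ V))
  let matrixRep : Module.End ℝ V →* Matrix _ _ ℂ :=
    toComplex.toMonoidHom.comp toMatrix.toMulEquiv.toMonoidHom
  have injective : Function.Injective matrixRep :=
    (Matrix.map_injective Complex.ofReal_injective).comp toMatrix.injective
  exact hβ _ Module.finrank_pos ((Units.map matrixRep).comp (QuotientGroup.kerLift ρ))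
    ((Units.map_injective injective).comp (QuotientGroup.kerLift_injective ρ))

end Quotient

section Gap

/-- If `t` were smaller, then `1 - t ≥ exp (-b / (2 * M))` and the power would be too large. -/
lemma le_of_pow_le_rpow_neg {X M b t : ℝ} {m : ℕ} (hX : 1 < X) (hb : 0 < b) (hbM : b ≤ 2 * M)
    (hm : m ≤ M * Real.log X) (hpow : (1 - t) ^ m ≤ X ^ (-b)) : b / (4 * M) ≤ t := by
  have M_pos : 0 < M := by linarith
  have log_pos : 0 < Real.log X := Real.log_pos hX
  set τ := b / (4 * M) with τ_eq
  have τ_pos : 0 < τ := by positivity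
  have τ_le : τ ≤ 1 / 2 := by rw [τ_eq, div_le_iff₀ (by positivity)]; linarith
  by_contra! t_lt
  have exp_lt : Real.exp (-(2 * τ)) < 1 - t := by
    calc Real.exp (-(2 * τ)) ≤ (1 + 2 * τ)⁻¹ := by
          rw [Real.exp_neg]
          exact inv_anti₀ (by positivity) (by linarith [Real.add_one_le_exp (2 * τ)])
      _ ≤ 1 - τ := by
          rw [inv_le_iff_one_le_mul₀ (by positivity)]
          nlinarith
      _ < 1 - t := by linarith
  have m_ne_zero : m ≠ 0 := by
    rintro rfl
    rw [pow_zero] at hpow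
    exact hpow.not_gt (Real.rpow_lt_one_of_one_lt_of_neg hX (neg_lt_zero.2 hb))
  have : Real.exp (m * -(2 * τ)) < Real.exp (Real.log X * -b) := by
    rw [Real.exp_nat_mul, ← Real.rpow_def_of_pos (by linarith)]
    exact (pow_lt_pow_left₀ exp_lt (Real.exp_nonneg _) m_ne_zero).trans_le hpow
  have exponent : (m : ℝ) * (2 * τ) ≤ b / 2 * Real.log X := by
    calc (m : ℝ) * (2 * τ) ≤ M * Real.log X * (2 * τ) := by gcongr
      _ = b / 2 * Real.log X := by rw [τ_eq]; field_simp; ring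
  nlinarith [Real.exp_lt_exp.1 this]

variable {G : Type*} [Group G] [Fintype G] {μ : G → ℝ} {β κ ε δ t : ℝ}

lemma le_gap_of_card_rpow_le (hμ : IsSymmProb μ) {f : G → ℝ} (hδ0 : 0 < δ) (hδ1 : δ ≤ 1)
    (hδκ : δ ≤ κ) (hconc : NonConcentration μ κ) (hf0 : f ≠ 0) (ht : t ≠ 0)
    (hf : conv μ f = (1 - t) • f) (hsmall : (Nat.card G : ℝ) ^ (δ / 5000) ≤ 40) :
    Real.exp (-(100000 / δ)) ≤ t := by
  refine le_trans ?_ (le_gap_of_nonConcentration hμ hδ0 hδ1 hδκ hconc hf0 ht hf)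
  have card_pos : (0 : ℝ) < Nat.card G := Nat.cast_pos.2 Nat.card_pos
  have card_le : (Nat.card G : ℝ) ≤ Real.exp (20000 / δ) := by
    have forty_le : (40 : ℝ) ≤ Real.exp 4 := by
      calc (40 : ℝ) ≤ 2.7 ^ 4 := by norm_num
        _ ≤ Real.exp 1 ^ 4 := by gcongr; linarith [Real.exp_one_gt_d9]
        _ = Real.exp 4 := by rw [← Real.exp_nat_mul]; norm_num
    calc (Nat.card G : ℝ) = ((Nat.card G : ℝ) ^ (δ / 5000)) ^ (5000 / δ) := by
          rw [← Real.rpow_mul card_pos.le, div_mul_div_cancel₀ (by norm_num), div_self hδ0.ne',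
            Real.rpow_one]
      _ ≤ Real.exp 4 ^ (5000 / δ) := by gcongr; exact hsmall.trans forty_le
      _ = Real.exp (20000 / δ) := by rw [← Real.exp_mul]; ring_nf
  have four_div_le : 4 / δ ≤ Real.exp (4 / δ) := by linarith [Real.add_one_le_exp (4 / δ)]
  calc Real.exp (-(100000 / δ)) ≤ Real.exp (-(4 / δ + 3 * (20000 / δ))) := by
        gcongr
        rw [← mul_div_assoc, ← add_div]
        gcongr
        norm_num
    _ = (Real.exp (4 / δ) * Real.exp (20000 / δ) ^ 3)⁻¹ := by
        rw [Real.exp_neg, Real.exp_add, ← Real.exp_nat_mul]; norm_num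
    _ ≤ (4 / δ * (Nat.card G : ℝ) ^ 3)⁻¹ := by gcongr
    _ = δ / (4 * (Nat.card G : ℝ) ^ 3) := by field_simp

lemma pow_le_of_sqNorm_convPow_le {n : ℕ} {b : ℝ} {W : Submodule ℝ (G → ℝ)}
    (hW : (Nat.card G : ℝ) ^ β ≤ Module.finrank ℝ W) (hWt : ∀ f ∈ W, conv μ f = (1 - t) • f)
    (hflat : sqNorm (convPow μ n) ≤ (Nat.card G : ℝ) ^ (b - 1)) :
    (1 - t) ^ (2 * n) ≤ (Nat.card G : ℝ) ^ (b - β) := by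
  have card_pos : (0 : ℝ) < Nat.card G := Nat.cast_pos.2 Nat.card_pos
  rw [Real.rpow_sub card_pos, le_div_iff₀' (by positivity)]
  calc (Nat.card G : ℝ) ^ β * (1 - t) ^ (2 * n)
      ≤ Module.finrank ℝ W * ((1 - t) ^ n) ^ 2 := by
        rw [mul_comm 2 n, pow_mul]
        gcongr
    _ ≤ Nat.card G * sqNorm (convPow μ n) :=
        finrank_mul_sq_le W fun f hf => conv_convPow_eq_smul (hWt f hf) n
    _ ≤ Nat.card G * (Nat.card G : ℝ) ^ (b - 1) := by gcongr
    _ = (Nat.card G : ℝ) ^ b := by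
        rw [Real.rpow_sub_one card_pos.ne', mul_div_cancel₀ _ card_pos.ne']

lemma two_pow_floor_le_exp (hδ0 : 0 < δ) (hδ1 : δ ≤ 1) :
    (2 : ℝ) ^ (⌊5000 / δ⌋₊ + 5) ≤ Real.exp (100000 / δ) := by
  calc (2 : ℝ) ^ (⌊5000 / δ⌋₊ + 5) ≤ Real.exp 1 ^ (⌊5000 / δ⌋₊ + 5) := by
        gcongr
        linarith [Real.add_one_le_exp 1]
    _ = Real.exp (⌊5000 / δ⌋₊ + 5) := by
        rw [← Real.exp_nat_mul]
        norm_num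
    _ ≤ Real.exp (100000 / δ) := by
        gcongr
        calc (⌊5000 / δ⌋₊ : ℝ) + 5 ≤ 5000 / δ + 5 / δ :=
              add_le_add (Nat.floor_le (by positivity)) (le_div_self (by norm_num) hδ0 hδ1)
          _ = 5005 / δ := by rw [← add_div]; norm_num
          _ ≤ 100000 / δ := by gcongr; norm_num

lemma le_gap_of_le_card_rpow (hμ : IsSymmProb μ) (hG : 1 < Nat.card G) (hβ0 : 0 < β) (hβ1 : β ≤ 1)
    (hδ0 : 0 < δ) (hδε : δ ≤ ε) (hεβ : 4 * ε ≤ β) (hεκ : 2 * ε ≤ κ)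
    (classification : ApproxSubgroupClassification G ε δ) (hconc : NonConcentration μ κ)
    {W : Submodule ℝ (G → ℝ)} (hW : (Nat.card G : ℝ) ^ β ≤ Module.finrank ℝ W)
    (hWt : ∀ f ∈ W, conv μ f = (1 - t) • f) (hlarge : 40 ≤ (Nat.card G : ℝ) ^ (δ / 5000)) :
    β * Real.exp (-(100000 / δ)) ≤ t := by
  have one_lt_card : (1 : ℝ) < Nat.card G := Nat.one_lt_cast.2 hG
  have rpow_pow (k : ℕ) :
      ((Nat.card G : ℝ) ^ (δ / 5000)) ^ k = (Nat.card G : ℝ) ^ (δ / 5000 * k) := by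
    rw [Real.rpow_mul (Nat.cast_nonneg _), Real.rpow_natCast]
  set J := ⌊5000 / δ⌋₊ + 1
  have lt_J : 1 < δ / 5000 * J := by
    have := Nat.lt_floor_add_one (5000 / δ)
    rw [div_lt_iff₀ hδ0] at this
    push_cast [J]
    linarith
  obtain ⟨n, n_le, flat⟩ := exists_sqNorm_convPow_le hμ hδε hεκ classification hconc hlarge
    (by rw [rpow_pow]; congr 1; push_cast; ring)
    (by rw [rpow_pow]; exact Real.self_lt_rpow_of_one_lt one_lt_card lt_J)
  have pow_le : (1 - t) ^ (2 * n) ≤ (Nat.card G : ℝ) ^ (-(β / 2)) :=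
    (pow_le_of_sqNorm_convPow_le hW hWt flat).trans
      (Real.rpow_le_rpow_of_exponent_le one_lt_card.le (by linarith))
  calc β * Real.exp (-(100000 / δ)) = β / Real.exp (100000 / δ) := by
        rw [Real.exp_neg, ← div_eq_mul_inv]
    _ ≤ β / 2 ^ (⌊5000 / δ⌋₊ + 5) := by gcongr; exact two_pow_floor_le_exp hδ0 (by linarith)
    _ = β / 2 / (4 * (2 * 2 ^ J)) := by rw [div_div]; congr 1; ring
    _ ≤ t := by
        refine le_of_pow_le_rpow_neg one_lt_card (by positivity) ?_ ?_ pow_le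
        · linarith [one_le_pow₀ one_le_two (M₀ := ℝ) (n := J)]
        · push_cast
          linarith

end Gap

end BGMachine

theorem proposition3p1_general {G₀ : Type*} [Group G₀] [Fintype G₀] [Nontrivial G₀]
    {S₀ : Finset G₀} (hsymm : ∀ s ∈ S₀, s⁻¹ ∈ S₀) (hgen : Subgroup.closure (S₀ : Set G₀) = ⊤)
    {β κ ε δ : ℝ} (hβ0 : 0 < β) (hβ1 : β ≤ 1) (hδ0 : 0 < δ) (hδε : δ ≤ ε) (hεβ : 4 * ε ≤ β)
    (hεκ : 2 * ε ≤ κ)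
    (h : ∀ (N : Subgroup G₀) [N.Normal] [Fintype (G₀ ⧸ N)],
      BGMachine.HighMultiplicity (G₀ ⧸ N) β ∧
      BGMachine.ApproxSubgroupClassification (G₀ ⧸ N) ε δ ∧
      BGMachine.NonConcentration
        (BGMachine.pushforward (QuotientGroup.mk' N) (BGMachine.uniformMeasure S₀)) κ) :
    β * Real.exp (-(100000 / δ)) ≤ BGMachine.lambda1 S₀ := by
  have S₀_nonempty : S₀.Nonempty :=
    (BGMachine.exists_mem_ne_one_of_closure_eq_top hgen).imp fun _ => And.left
  refine le_csInf (BGMachine.exists_laplacian_hasEigenvalue_ne_zero hsymm hgen) ?_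
  rintro t ⟨ht, hev⟩
  let N := (BGMachine.eigenspaceRep S₀ t).ker
  have := Fintype.ofFinite (G₀ ⧸ N)
  have : Nontrivial ((BGMachine.laplacian S₀).eigenspace t) :=
    Submodule.nontrivial_iff_ne_bot.2 hev
  obtain ⟨multiplicity, classification, concentration⟩ := h N
  have finrank_ge := multiplicity.card_rpow_le_finrank
  rw [← BGMachine.finrank_quotientEigenspace] at finrank_ge
  have hμ := (BGMachine.isSymmProb_uniformMeasure S₀_nonempty hsymm).pushforward
    (QuotientGroup.mk' N)
  rcases le_total ((Nat.card (G₀ ⧸ N) : ℝ) ^ (δ / 5000)) 40 with small | large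
  · obtain ⟨f, hf, hf0⟩ := BGMachine.exists_mem_quotientEigenspace_ne_zero hev
    exact (mul_le_of_le_one_left (Real.exp_nonneg _) hβ1).trans
      (BGMachine.le_gap_of_card_rpow_le hμ hδ0 (by linarith) (by linarith) concentration hf0 ht
        (BGMachine.conv_eq_smul_of_mem_quotientEigenspace hf) small)
  · exact BGMachine.le_gap_of_le_card_rpow hμ
      (Subgroup.one_lt_index_of_ne_top (BGMachine.ker_eigenspaceRep_ne_top S₀_nonempty ht hev))
      hβ0 hβ1 hδ0 hδε hεβ hεκ classification concentration finrank_ge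
      (fun _ => BGMachine.conv_eq_smul_of_mem_quotientEigenspace) large

theorem proposition3p1 :
    ∃ C : ℝ, 0 < C ∧
      ∀ (G₀ : Type*) [Group G₀] [Fintype G₀] [Nontrivial G₀] (S₀ : Finset G₀),
        (∀ s ∈ S₀, s⁻¹ ∈ S₀) →
        Subgroup.closure (S₀ : Set G₀) = ⊤ →
        ∀ (β κ : ℝ), 0 < β → β < 1 → 0 < κ → κ < 1 →
        ∀ δ : ℝ → ℝ, (∀ ε : ℝ, 0 < ε → 0 < δ ε ∧ δ ε < ε) →
        -- the three conditions, for every quotient `G₀ ⧸ N`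
        (∀ (N : Subgroup G₀) [N.Normal] [Fintype (G₀ ⧸ N)],
          BGMachine.HighMultiplicity (G₀ ⧸ N) β ∧
          (∀ ε : ℝ, 0 < ε → BGMachine.ApproxSubgroupClassification (G₀ ⧸ N) ε (δ ε)) ∧
          BGMachine.NonConcentration
            (BGMachine.pushforward (QuotientGroup.mk' N) (BGMachine.uniformMeasure S₀)) κ) →
        β * Real.exp (-(C / δ (min β κ / 4))) ≤ BGMachine.lambda1 S₀ := by
  refine ⟨100000, by norm_num, ?_⟩
  intro G₀ _ _ _ S₀ hsymm hgen β κ hβ0 hβ1 hκ0 _ δ hδ h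
  have hε : 0 < min β κ / 4 := by positivity
  exact proposition3p1_general hsymm hgen hβ0 hβ1.le (hδ _ hε).1 (hδ _ hε).2.le
    (by linarith [min_le_left β κ]) (by linarith [min_le_right β κ])
    fun N _ _ => ⟨(h N).1, (h N).2.1 _ hε, (h N).2.2⟩
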